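/- **Setting.** Let $\mathbb D$ be the open unit disk, $dA$ the area measure on $\mathbb D$ normalized by $A(\mathbb D)=1$, and, for $\alpha>-1$, $dA_\alpha(w)=(\alpha+1)(1-|w|^2)^\alpha\,dA(w)$. For $0<p<\infty$ put $\|f\|_{p,\alpha}=\big(\int_{\mathbb D}|f|^p\,dA_\alpha\big)^{1/p}$, and let $L^p_a(dA_\alpha)$ be the space of analytic functions $f$ on $\mathbb D$ with $\|f\|_{p,\alpha}<\infty$. For $z,w\in\mathbb D$ let $$K_z(w)=\frac1{(1-\bar z w)^{2+\alpha}},\qquad k_z=(1-|z|^2)^{\frac{2+\alpha}2}K_z,\qquad \varphi_z(w)=\frac{z-w}{1-\bar z w},\qquad U_zf=(f\circ\varphi_z)\,k_z .$$ By a linear operator $S$ from $L^p_a(dA_\alpha)$ to $L^q_a(dA_\alpha)$ we mean a linear map into $L^q_a(dA_\alpha)$ whose domain is a linear subspace of $L^p_a(dA_\alpha)$ (possibly all of it) that contains every $K_z$, $z\in\mathbb D$. Put $S_z=U_zSU_z$; since $U_z1=k_z$, the function $S_z1=U_zSk_z$ is defined for every $z\in\mathbb D$. The operator $S$ is closable if,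 whenever $f_n$ in its domain and $g\in L^q_a(dA_\alpha)$ satisfy $\|f_n\|_{p,\alpha}\to0$ and $\|Sf_n-g\|_{q,\alpha}\to0$, one has $g=0$. **Theorem 2.10.** Let $2<p<\infty$, $\alpha>-1$, $0<q<\infty$ and $$\frac{p(2+\alpha)}{(p-1)(1+\alpha)}<m\le\frac{p(2+\alpha)}{1+\alpha},$$ and suppose that (a) $p\ge m$ and $q<m\,\frac{1+\alpha}{2+\alpha}$, or (b) $p<m$ and $q<\frac p{2+\alpha}$. Then there is a constant $K>0$, depending only on $p,q,m,\alpha$, such that the following holds. If $S$ is a closable linear operator from $L^p_a(dA_\alpha)$ to $L^q_a(dA_\alpha)$ and $C>0$ is a constant with $\|S_z1\|_{m,\alpha}\le C$ for all $z\in\mathbb D$, then $S$ is bounded: it extends to (and, if it is defined on all of $L^p_a(dA_\alpha)$, it is) a linear operator $T:L^p_a(dA_\alpha)\to L^q_a(dA_\alpha)$ with $$\|Tf\|_{q,\alpha}\le K\,C\,\|f\|_{p,\alpha}\qquad\text{for all } f\in L^p_a(dA_\alpha).$$ -/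

import Mathlib

open MeasureTheory Filter Topology
open scoped ENNReal ComplexConjugate

noncomputable section

namespace WeightedBergman

/-- The open unit disk of the complex plane. -/
abbrev Disc : Type := Metric.ball (0 : ℂ) 1

/-- The weighted area measure `dA_α(w) = (α + 1) (1 - |w|²)^α dA(w)` on the disk, where `dA` is
area measure divided by `π`. -/
def dA (α : ℝ) : Measure Disc :=
  ((volume : Measure ℂ).comap (Subtype.val : Disc → ℂ)).withDensity
    (fun w => ENNReal.ofReal ((α + 1) / Real.pi * (1 - ‖(w : ℂ)‖ ^ 2) ^ α))

/-- `‖f‖_{p,α} = (∫ |f|^p dA_α)^(1/p)`, for `0 < p < ∞`, as an extended nonnegative real. -/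
def bnorm (p α : ℝ) (f : Disc → ℂ) : ℝ≥0∞ :=
  eLpNorm f (ENNReal.ofReal p) (dA α)

/-- The Bergman space `L^p_a(dA_α)`: the analytic functions on the disk that belong to
`L^p(dA_α)`. -/
def bergmanSpace (p α : ℝ) : Submodule ℂ (Disc → ℂ) where
  carrier := {f | (∃ F : ℂ → ℂ, DifferentiableOn ℂ F (Metric.ball 0 1) ∧ ∀ w : Disc, f w = F w) ∧
    MemLp f (ENNReal.ofReal p) (dA α)}
  add_mem' := by
    rintro f g ⟨⟨F, hF, hfF⟩, hf⟩ ⟨⟨G, hG, hgG⟩, hg⟩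
    exact ⟨⟨F + G, hF.add hG, fun w => by simp [hfF, hgG]⟩, hf.add hg⟩
  zero_mem' := ⟨⟨0, differentiableOn_const 0, fun _ => rfl⟩, MemLp.zero⟩
  smul_mem' := by
    rintro c f ⟨⟨F, hF, hfF⟩, hf⟩
    exact ⟨⟨c • F, hF.const_smul c, fun w => by simp [hfF]⟩, hf.const_smul c⟩

/-- The reproducing kernel `K_z(w) = (1 - conj z * w)^(-(2 + α))` (principal branch; the base has
positive real part). -/
def kernel (α : ℝ) (z : Disc) : Disc → ℂ :=
  fun w => 1 / (1 - conj (z : ℂ) * (w : ℂ)) ^ ((2 + α : ℝ) : ℂ)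

/-- The normalized reproducing kernel `k_z = (1 - |z|²)^((2 + α) / 2) K_z`. -/
def normKernel (α : ℝ) (z : Disc) : Disc → ℂ :=
  (((1 - ‖(z : ℂ)‖ ^ 2) ^ ((2 + α) / 2) : ℝ) : ℂ) • kernel α z

lemma moebius_mem (z w : Disc) :
    ((z : ℂ) - w) / (1 - conj (z : ℂ) * w) ∈ Metric.ball (0 : ℂ) 1 := by
  have hz : ‖(z : ℂ)‖ < 1 := mem_ball_zero_iff.1 z.2
  have hw : ‖(w : ℂ)‖ < 1 := mem_ball_zero_iff.1 w.2
  have key : ‖1 - conj (z : ℂ) * w‖ ^ 2 - ‖(z : ℂ) - w‖ ^ 2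
      = (1 - ‖(z : ℂ)‖ ^ 2) * (1 - ‖(w : ℂ)‖ ^ 2) := by
    simp only [← Complex.normSq_eq_norm_sq, Complex.normSq_apply, Complex.sub_re, Complex.sub_im,
      Complex.mul_re, Complex.mul_im, Complex.conj_re, Complex.conj_im, Complex.one_re,
      Complex.one_im]
    ring
  have hpos : 0 < (1 - ‖(z : ℂ)‖ ^ 2) * (1 - ‖(w : ℂ)‖ ^ 2) :=
    mul_pos (by nlinarith [norm_nonneg (z : ℂ)]) (by nlinarith [norm_nonneg (w : ℂ)])
  have hlt : ‖(z : ℂ) - w‖ < ‖1 - conj (z : ℂ) * w‖ :=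
    lt_of_pow_lt_pow_left₀ 2 (norm_nonneg _) (by linarith)
  rw [mem_ball_zero_iff, norm_div]
  exact (div_lt_one (lt_of_le_of_lt (norm_nonneg _) hlt)).2 hlt

/-- The Möbius transformation `φ_z(w) = (z - w) / (1 - conj z * w)` of the disk. -/
def moebius (z w : Disc) : Disc :=
  ⟨((z : ℂ) - w) / (1 - conj (z : ℂ) * w), moebius_mem z w⟩

/-- `U_z f = (f ∘ φ_z) · k_z`. -/
def U (α : ℝ) (z : Disc) (f : Disc → ℂ) : Disc → ℂ :=
  fun w => f (moebius z w) * normKernel α z w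

/-- A linear operator from `L^p_a(dA_α)` to `L^q_a(dA_α)`, possibly defined only on a linear
subspace of `L^p_a(dA_α)`, whose domain contains all reproducing kernels. -/
structure Operator (p q α : ℝ) where
  /-- The domain of the operator. -/
  domain : Submodule ℂ (Disc → ℂ)
  domain_le : domain ≤ bergmanSpace p α
  kernel_mem : ∀ z : Disc, kernel α z ∈ domain
  /-- The linear map itself. -/
  toFun : domain →ₗ[ℂ] bergmanSpace q α

namespace Operator

variable {p q α : ℝ}

lemma U_one_mem (S : Operator p q α) (z : Disc) : U α z 1 ∈ S.domain := by
  have h : U α z 1 = normKernel α z := by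
    funext w
    simp [U]
  rw [h]
  exact S.domain.smul_mem _ (S.kernel_mem z)

/-- `S_z f = U_z S U_z f`, for `U_z f` in the domain of `S`. -/
def conjU (S : Operator p q α) (z : Disc) (f : Disc → ℂ) (hf : U α z f ∈ S.domain) : Disc → ℂ :=
  U α z (S.toFun ⟨U α z f, hf⟩ : Disc → ℂ)

/-- The function `S_z 1`. -/
def conjOne (S : Operator p q α) (z : Disc) : Disc → ℂ :=
  S.conjU z 1 (S.U_one_mem z)

/-- `S` is closable: if `f_n → 0` in `L^p_a(dA_α)`, with `f_n` in the domain of `S`, and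
`S f_n → g` in `L^q_a(dA_α)`, then `g = 0`. -/
def IsClosable (S : Operator p q α) : Prop :=
  ∀ (f : ℕ → S.domain) (g : bergmanSpace q α),
    Tendsto (fun n => bnorm p α (f n : Disc → ℂ)) atTop (𝓝 0) →
    Tendsto (fun n => bnorm q α ((S.toFun (f n) : Disc → ℂ) - (g : Disc → ℂ))) atTop (𝓝 0) →
    g = 0

/-- `T`, defined on all of `L^p_a(dA_α)`, coincides with `S` on the domain of `S`. -/
def ExtendsTo (S : Operator p q α) (T : bergmanSpace p α →ₗ[ℂ] bergmanSpace q α) : Prop :=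
  ∀ f : S.domain, T ⟨f, S.domain_le f.2⟩ = S.toFun f

end Operator

end WeightedBergman

end

noncomputable section

namespace WeightedBergman

/-! The reproducing formula writes `f` as the superposition `∫ f(z) K_z dA_α(z)`, so a bounded
extension of `S` must be `Tf(w) = ∫ f(z) (S K_z)(w) dA_α(z)`. The proof has to bound this integral
operator and show that it agrees with `S` on the domain of `S`.

Boundedness. The substitution `w = φ_z(u)` turns `‖S_z 1‖_{m,α} ≤ C` into a weighted `L^m` bound on
`|S K_z|`, uniform in `z` (`lintegral_conjOne`, `KernelBound`). This bound serves as one half of a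
Schur test (`lintegral_schur`); the other half is an explicit product of powers of `1 - |z|²`, `1 -
|w|²` and `|1 - z̄w|`, integrated by the Forelli–Rudin estimates. For exponents below `p` the test
is combined with Hölder's inequality in `z` (`exists_lintegral_kernel_le_of_lt`); for `p < m`
Hölder's inequality in `w` first lowers `m` to `p` (`exists_lintegral_kernel_le_of_gt`). In both
cases the lower bound on `m` is what leaves room for the auxiliary powers. The target is `L^r` with
`q ≤ r < m`: `r` is slightly below `m` when `m ≤ p`, and `r = p` when `p < m`.

Agreement with `S`. Closability is used twice. It first makes `z ↦ S K_z` continuous into `L^r`: the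
functions `S K_z` are locally bounded in `L^m`, so by Montel's theorem they are precompact in `L^r`
for `r < m`, and closability identifies each limit point (`tendsto_eLpNorm_kern`). Hence `z ↦ f(z)
(K_z, S K_z)` can be Bochner integrated over compact subsets of the disk; the integrals stay in the
closure of the graph of `S` in `L^p × L^r` and converge to `(f, Tf)` (`mem_closure_graphLp`). The
second use of closability then gives `Tf = Sf` on the domain (`exists_extension`). -/

/-! ### Geometry of the disk and its Möbius involutions. -/

/-- The defining function `1 - |z|²` of the disk. -/
def rho (z : Disc) : ℝ := 1 - ‖(z : ℂ)‖ ^ 2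

/-- The modulus `|1 - conj z * w|`. -/
def kdist (z w : Disc) : ℝ := ‖1 - conj (z : ℂ) * w‖

lemma norm_lt_one (z : Disc) : ‖(z : ℂ)‖ < 1 := mem_ball_zero_iff.1 z.2

lemma rho_pos (z : Disc) : 0 < rho z := by
  have := norm_lt_one z
  unfold rho
  nlinarith [norm_nonneg (z : ℂ)]

lemma kdist_comm (z w : Disc) : kdist z w = kdist w z := by
  unfold kdist
  rw [← Complex.norm_conj]
  simp [mul_comm]

lemma one_sub_norm_le_kdist (z w : Disc) : 1 - ‖(z : ℂ)‖ ≤ kdist z w := by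
  have h := norm_sub_norm_le (1 : ℂ) (conj (z : ℂ) * w)
  rw [norm_one, norm_mul, Complex.norm_conj] at h
  unfold kdist
  nlinarith [norm_nonneg (z : ℂ), norm_lt_one w]

lemma kdist_pos (z w : Disc) : 0 < kdist z w :=
  (sub_pos.2 (norm_lt_one z)).trans_le (one_sub_norm_le_kdist z w)

lemma half_rho_le_kdist (z w : Disc) : rho z / 2 ≤ kdist z w := by
  refine le_trans ?_ (one_sub_norm_le_kdist z w)
  unfold rho
  nlinarith [norm_nonneg (z : ℂ), norm_lt_one z]

lemma kdist_le_two (z w : Disc) : kdist z w ≤ 2 := by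
  have h := norm_sub_le (1 : ℂ) (conj (z : ℂ) * w)
  rw [norm_one, norm_mul, Complex.norm_conj] at h
  unfold kdist
  nlinarith [norm_nonneg (z : ℂ), norm_nonneg (w : ℂ), norm_lt_one w, norm_lt_one z]

lemma one_sub_ne_zero (z w : Disc) : 1 - conj (z : ℂ) * w ≠ 0 :=
  norm_pos_iff.1 (kdist_pos z w)

lemma continuous_rho : Continuous rho := by unfold rho; fun_prop

lemma continuous_kdist : Continuous fun x : Disc × Disc => kdist x.1 x.2 := by
  unfold kdist
  have : Continuous fun x : Disc × Disc => conj (x.1 : ℂ) :=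
    Complex.continuous_conj.comp (by fun_prop)
  fun_prop

@[fun_prop]
lemma measurable_rho : Measurable rho := continuous_rho.measurable

lemma measurable_kdist_prod : Measurable fun x : Disc × Disc => kdist x.1 x.2 := by
  have := continuous_kdist
  fun_prop

@[fun_prop]
lemma measurable_kdist {X : Type*} [MeasurableSpace X] {f g : X → Disc} (hf : Measurable f)
    (hg : Measurable g) : Measurable fun x => kdist (f x) (g x) := by
  have h := measurable_kdist_prod.comp (hf.prodMk hg)
  exact h

lemma one_sub_conj_mul_moebius (z w : Disc) :
    1 - conj (z : ℂ) * (moebius z w : ℂ) = (rho z : ℂ) / (1 - conj (z : ℂ) * w) := by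
  have h := one_sub_ne_zero z w
  have h1 : (rho z : ℂ) = 1 - conj (z : ℂ) * z := by
    rw [← Complex.normSq_eq_conj_mul_self, Complex.normSq_eq_norm_sq, rho]
    push_cast; ring
  rw [h1]
  simp only [moebius]
  field_simp
  ring

lemma kdist_moebius (z w : Disc) : kdist z (moebius z w) = rho z / kdist z w := by
  rw [kdist, one_sub_conj_mul_moebius, norm_div, Complex.norm_real, Real.norm_of_nonneg
    (rho_pos z).le, kdist]

lemma moebius_moebius (z w : Disc) : moebius z (moebius z w) = w := by
  have h := one_sub_ne_zero z w
  have h' : (rho z : ℂ) ≠ 0 := by exact_mod_cast (rho_pos z).ne'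
  have h1 : (rho z : ℂ) = 1 - conj (z : ℂ) * z := by
    rw [← Complex.normSq_eq_conj_mul_self, Complex.normSq_eq_norm_sq, rho]
    push_cast; ring
  apply Subtype.ext
  change ((z : ℂ) - (moebius z w : ℂ)) / (1 - conj (z : ℂ) * (moebius z w : ℂ)) = w
  rw [one_sub_conj_mul_moebius, div_div_eq_mul_div, div_eq_iff h']
  have : (moebius z w : ℂ) = ((z : ℂ) - w) / (1 - conj (z : ℂ) * w) := rfl
  rw [this, h1, sub_mul, div_mul_cancel₀ _ h]
  ring

lemma rho_moebius (z w : Disc) : rho (moebius z w) = rho z * rho w / kdist z w ^ 2 := by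
  have h := (kdist_pos z w).ne'
  have key : kdist z w ^ 2 - ‖(z : ℂ) - w‖ ^ 2 = rho z * rho w := by
    simp only [rho, kdist, ← Complex.normSq_eq_norm_sq, Complex.normSq_apply, Complex.sub_re,
      Complex.sub_im, Complex.mul_re, Complex.mul_im, Complex.conj_re, Complex.conj_im,
      Complex.one_re, Complex.one_im]
    ring
  have : ‖(moebius z w : ℂ)‖ = ‖(z : ℂ) - w‖ / kdist z w := by
    simp [moebius, kdist]
  rw [rho, this, ← key]
  field_simp

lemma norm_kernel (α : ℝ) (z w : Disc) : ‖kernel α z w‖ = kdist z w ^ (-(2 + α)) := by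
  rw [kernel, norm_div, norm_one, Complex.norm_cpow_real, Real.rpow_neg (kdist_pos z w).le,
    one_div, kdist]

lemma norm_normKernel (α : ℝ) (z w : Disc) :
    ‖normKernel α z w‖ = rho z ^ ((2 + α) / 2) * kdist z w ^ (-(2 + α)) := by
  have h : 0 ≤ (1 - ‖(z : ℂ)‖ ^ 2) ^ ((2 + α) / 2) := Real.rpow_nonneg (rho_pos z).le _
  rw [normKernel, Pi.smul_apply, norm_smul, norm_kernel, Complex.norm_real,
    Real.norm_of_nonneg h, rho]

lemma continuous_moebius (z : Disc) : Continuous (moebius z) := by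
  refine Continuous.subtype_mk (Continuous.div (by fun_prop) (by fun_prop) ?_) _
  exact fun w => one_sub_ne_zero z w

/-! ### The measure `dA α`: polar coordinates, total mass, Möbius and rotation changes of variables.
-/

lemma lintegral_dA (α : ℝ) (g : ℂ → ℝ≥0∞) :
    ∫⁻ w : Disc, g w ∂(dA α) = ∫⁻ w in Metric.ball (0 : ℂ) 1,
      ENNReal.ofReal ((α + 1) / Real.pi * (1 - ‖w‖ ^ 2) ^ α) * g w := by
  rw [dA, lintegral_withDensity_eq_lintegral_mul_non_measurable]
  · exact lintegral_subtype_comap (s := Metric.ball (0 : ℂ) 1) measurableSet_ball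
      (fun w => ENNReal.ofReal ((α + 1) / Real.pi * (1 - ‖w‖ ^ 2) ^ α) * g w)
  · fun_prop
  · exact ae_of_all _ fun _ => ENNReal.ofReal_lt_top

lemma lintegral_ball_polar {R Θ : ℝ → ℝ≥0∞} (hR : Measurable R) (hΘ : Measurable Θ) :
    ∫⁻ w in Metric.ball (0 : ℂ) 1, R ‖w‖ * Θ (Complex.arg w)
      = (∫⁻ r in Set.Ioo (0 : ℝ) 1, ENNReal.ofReal r * R r) *
        ∫⁻ θ in Set.Ioo (-Real.pi) Real.pi, Θ θ := by
  rw [← lintegral_indicator measurableSet_ball, ← Complex.lintegral_comp_polarCoord_symm,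
    ← lintegral_prod_mul (by fun_prop) (by fun_prop), Measure.prod_restrict,
    ← lintegral_indicator (measurableSet_Ioo.prod measurableSet_Ioo),
    ← lintegral_indicator (polarCoord.open_target.measurableSet)]
  refine lintegral_congr fun x => ?_
  by_cases hx : x ∈ polarCoord.target
  · have hx' := hx
    rw [polarCoord_target, Set.mem_prod] at hx'
    have hn : ‖Complex.polarCoord.symm x‖ = x.1 := by
      rw [Complex.norm_polarCoord_symm, abs_of_pos hx'.1]
    have ha : Complex.arg (Complex.polarCoord.symm x) = x.2 := by
      rw [Complex.polarCoord_symm_apply]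
      have := Complex.arg_mul_cos_add_sin_mul_I hx'.1 ⟨hx'.2.1, hx'.2.2.le⟩
      simpa using this
    rw [Set.indicator_of_mem hx]
    by_cases h1 : x.1 < 1
    · rw [Set.indicator_of_mem (by rw [mem_ball_zero_iff, hn]; exact h1),
        Set.indicator_of_mem (by exact ⟨⟨hx'.1, h1⟩, hx'.2⟩), hn, ha, smul_eq_mul, mul_assoc]
    · rw [Set.indicator_of_notMem (by rw [mem_ball_zero_iff, hn]; exact h1),
        Set.indicator_of_notMem (by exact fun h => h1 h.1.2), smul_zero]
  · rw [Set.indicator_of_notMem hx, Set.indicator_of_notMem]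
    exact fun h => hx ⟨h.1.1, h.2⟩

lemma lintegral_radial {α : ℝ} (hα : -1 < α) :
    ∫⁻ r in Set.Ioo (0 : ℝ) 1, ENNReal.ofReal r * ENNReal.ofReal ((1 - r ^ 2) ^ α)
      = ENNReal.ofReal (1 / (2 * (α + 1))) := by
  set g : ℝ → ℝ := fun r => -(1 - r ^ 2) ^ (α + 1) / (2 * (α + 1)) with hg
  have hα' : 0 < α + 1 := by linarith
  have hc : ContinuousOn g (Set.Icc 0 1) := by
    refine Continuous.continuousOn ?_
    refine (Continuous.neg ?_).div_const _
    exact Continuous.rpow_const (by fun_prop) fun _ => Or.inr hα'.le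
  have hd : ∀ r ∈ Set.Ioo (0 : ℝ) 1, HasDerivAt g (r * (1 - r ^ 2) ^ α) r := by
    intro r hr
    have hpos : 0 < 1 - r ^ 2 := by nlinarith [hr.1, hr.2]
    have h1 : HasDerivAt (fun r : ℝ => 1 - r ^ 2) (-(2 * r)) r := by
      simpa using (hasDerivAt_pow 2 r).const_sub 1
    have h2 := ((h1.rpow_const (p := α + 1) (Or.inl hpos.ne')).neg).div_const (2 * (α + 1))
    have e : r * (1 - r ^ 2) ^ α
        = -(-(2 * r) * (α + 1) * (1 - r ^ 2) ^ (α + 1 - 1)) / (2 * (α + 1)) := by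
      rw [add_sub_cancel_right]
      field_simp
    rw [e]
    exact h2
  have hnn : ∀ r ∈ Set.Ioo (0 : ℝ) 1, 0 ≤ r * (1 - r ^ 2) ^ α := fun r hr =>
    mul_nonneg hr.1.le (Real.rpow_nonneg (by nlinarith [hr.1, hr.2]) _)
  have hi := intervalIntegral.integrableOn_deriv_of_nonneg hc hd hnn
  have hint := intervalIntegral.integral_eq_sub_of_hasDeriv_right_of_le zero_le_one hc
    (fun r hr => (hd r hr).hasDerivWithinAt)
    ((intervalIntegrable_iff_integrableOn_Ioc_of_le zero_le_one).2 hi)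
  rw [intervalIntegral.integral_of_le zero_le_one, integral_Ioc_eq_integral_Ioo] at hint
  have hval : g 1 - g 0 = 1 / (2 * (α + 1)) := by
    simp [hg, Real.zero_rpow hα'.ne']
    field_simp
  rw [← hval, ← hint, ofReal_integral_eq_lintegral_ofReal
    (hi.mono_set Set.Ioo_subset_Ioc_self)
    ((ae_restrict_iff' measurableSet_Ioo).2 (ae_of_all _ hnn))]
  refine setLIntegral_congr_fun measurableSet_Ioo fun r hr => ?_
  rw [ENNReal.ofReal_mul hr.1.le]

lemma dA_univ {α : ℝ} (hα : -1 < α) : dA α Set.univ = 1 := by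
  have hα' : 0 < α + 1 := by linarith
  have h := lintegral_dA α 1
  simp only [Pi.one_apply, lintegral_one, mul_one] at h
  rw [h]
  have h1 := lintegral_ball_polar
    (R := fun r => ENNReal.ofReal ((α + 1) / Real.pi * (1 - r ^ 2) ^ α)) (Θ := 1)
    (by fun_prop) measurable_one
  simp only [Pi.one_apply, mul_one, lintegral_one, Measure.restrict_apply_univ,
    Real.volume_Ioo] at h1
  rw [h1]
  have h2 : ∀ r : ℝ, ENNReal.ofReal r * ENNReal.ofReal ((α + 1) / Real.pi * (1 - r ^ 2) ^ α)
      = ENNReal.ofReal ((α + 1) / Real.pi) *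
        (ENNReal.ofReal r * ENNReal.ofReal ((1 - r ^ 2) ^ α)) := by
    intro r
    rw [ENNReal.ofReal_mul (div_pos hα' Real.pi_pos).le]
    ring
  simp_rw [h2]
  rw [lintegral_const_mul _ (by fun_prop), lintegral_radial hα, ← ENNReal.ofReal_mul
    (div_pos hα' Real.pi_pos).le, ← ENNReal.ofReal_mul (by positivity), ← ENNReal.ofReal_one]
  congr 1
  field_simp
  ring

lemma isProbabilityMeasure_dA {α : ℝ} (hα : -1 < α) : IsProbabilityMeasure (dA α) :=
  ⟨dA_univ hα⟩

/-- Changing the weight of the measure. -/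
lemma lintegral_rho_rpow_mul {α s : ℝ} (hα : -1 < α) (hs : -1 < s) (g : Disc → ℝ≥0∞) :
    ∫⁻ w, ENNReal.ofReal (rho w ^ (s - α)) * g w ∂(dA α)
      = ENNReal.ofReal ((α + 1) / (s + 1)) * ∫⁻ w, g w ∂(dA s) := by
  have hα' : 0 < α + 1 := by linarith
  have hs' : 0 < s + 1 := by linarith
  rw [dA, dA, lintegral_withDensity_eq_lintegral_mul_non_measurable _ (by fun_prop)
    (ae_of_all _ fun _ => ENNReal.ofReal_lt_top),
    lintegral_withDensity_eq_lintegral_mul_non_measurable _ (by fun_prop)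
    (ae_of_all _ fun _ => ENNReal.ofReal_lt_top), ← lintegral_const_mul' _ _ ENNReal.ofReal_ne_top]
  refine lintegral_congr fun w => ?_
  simp only [Pi.mul_apply]
  rw [← mul_assoc, ← mul_assoc]
  congr 1
  change ENNReal.ofReal ((α + 1) / Real.pi * rho w ^ α) * _ = _ *
    ENNReal.ofReal ((s + 1) / Real.pi * rho w ^ s)
  have := rho_pos w
  rw [← ENNReal.ofReal_mul (by positivity), ← ENNReal.ofReal_mul (by positivity)]
  congr 1
  rw [Real.rpow_sub this]
  have := Real.rpow_pos_of_pos this α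
  field_simp

/-- Extension of a function on the disk to the plane. -/
def extendDisc {β : Type*} [Zero β] (g : Disc → β) (x : ℂ) : β :=
  open Classical in if h : x ∈ Metric.ball (0 : ℂ) 1 then g ⟨x, h⟩ else 0

lemma extendDisc_coe {β : Type*} [Zero β] (g : Disc → β) (w : Disc) : extendDisc g w = g w := by
  rw [extendDisc, dif_pos w.2]

lemma extendDisc_mem {β : Type*} [Zero β] (g : Disc → β) {x : ℂ}
    (h : x ∈ Metric.ball (0 : ℂ) 1) : extendDisc g x = g ⟨x, h⟩ := by
  rw [extendDisc, dif_pos h]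

lemma lintegral_dA' (α : ℝ) (g : Disc → ℝ≥0∞) :
    ∫⁻ w, g w ∂(dA α) = ∫⁻ w in Metric.ball (0 : ℂ) 1,
      ENNReal.ofReal ((α + 1) / Real.pi * (1 - ‖w‖ ^ 2) ^ α) * extendDisc g w := by
  rw [← lintegral_dA]
  simp_rw [extendDisc_coe]

lemma hasDerivAt_moebius (z w : Disc) :
    HasDerivAt (fun x : ℂ => ((z : ℂ) - x) / (1 - conj (z : ℂ) * x))
      (-(rho z : ℂ) / (1 - conj (z : ℂ) * w) ^ 2) w := by
  have h := one_sub_ne_zero z w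
  have h1 : (rho z : ℂ) = 1 - conj (z : ℂ) * z := by
    rw [← Complex.normSq_eq_conj_mul_self, Complex.normSq_eq_norm_sq, rho]
    push_cast; ring
  have h2 := ((hasDerivAt_id (w : ℂ)).const_sub (z : ℂ)).div
    (((hasDerivAt_id (w : ℂ)).const_mul (conj (z : ℂ))).const_sub 1) h
  have e : -(rho z : ℂ) / (1 - conj (z : ℂ) * w) ^ 2
      = (-1 * (1 - conj (z : ℂ) * id (w : ℂ)) - ((z : ℂ) - id (w : ℂ)) * -(conj (z : ℂ) * 1)) /
        (1 - conj (z : ℂ) * id (w : ℂ)) ^ 2 := by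
    rw [h1]
    simp only [id]
    congr 1
    ring
  rw [e]
  exact h2

lemma det_smul_one (c : ℂ) : (c • (1 : ℂ →L[ℝ] ℂ)).det = ‖c‖ ^ 2 := by
  rw [ContinuousLinearMap.det, ← LinearMap.det_toMatrix Complex.basisOneI, Matrix.det_fin_two,
    ← Complex.normSq_eq_norm_sq, Complex.normSq_apply]
  simp [LinearMap.toMatrix_apply]

/-- The real Jacobian `|φ_z'|² = rho z ^ 2 / kdist z w ^ 4` combines with the quotient of the
weights `(rho (φ_z w) / rho w) ^ α = (rho z / kdist z w ^ 2) ^ α`. -/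
lemma lintegral_moebius {α : ℝ} (z : Disc) (g : Disc → ℝ≥0∞) :
    ∫⁻ w, ENNReal.ofReal (rho z ^ (2 + α) * kdist z w ^ (-(2 * (2 + α)))) * g (moebius z w) ∂(dA α)
      = ∫⁻ w, g w ∂(dA α) := by
  set f : ℂ → ℂ := fun x : ℂ => ((z : ℂ) - x) / (1 - conj (z : ℂ) * x) with hf
  have hfm : ∀ w : Disc, f w = moebius z w := fun w => rfl
  have himg : f '' Metric.ball 0 1 = Metric.ball 0 1 := by
    ext x
    constructor
    · rintro ⟨y, hy, rfl⟩
      exact (moebius z ⟨y, hy⟩).2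
    · intro hx
      refine ⟨moebius z ⟨x, hx⟩, (moebius z ⟨x, hx⟩).2, ?_⟩
      rw [hfm, moebius_moebius]
  have hinj : Set.InjOn f (Metric.ball 0 1) := by
    intro x hx y hy hxy
    have h1 : moebius z ⟨x, hx⟩ = moebius z ⟨y, hy⟩ := Subtype.ext hxy
    have h2 := congrArg (moebius z) h1
    rw [moebius_moebius, moebius_moebius] at h2
    exact congrArg Subtype.val h2
  rw [lintegral_dA', lintegral_dA']
  conv_rhs => rw [← himg]
  have hderiv : ∀ x ∈ Metric.ball (0 : ℂ) 1, HasFDerivWithinAt f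
      ((-(rho z : ℂ) / (1 - conj (z : ℂ) * x) ^ 2) • (1 : ℂ →L[ℝ] ℂ)) (Metric.ball 0 1) x :=
    fun x hx => ((hasDerivAt_moebius z ⟨x, hx⟩).complexToReal_fderiv).hasFDerivWithinAt
  rw [lintegral_image_eq_lintegral_abs_det_fderiv_mul volume measurableSet_ball hderiv hinj]
  refine setLIntegral_congr_fun measurableSet_ball fun x hx => ?_
  have hx1 : (1 : ℝ) - ‖x‖ ^ 2 = rho ⟨x, hx⟩ := rfl
  have hx2 : f x = moebius z ⟨x, hx⟩ := rfl
  have hx3 : (1 : ℝ) - ‖f x‖ ^ 2 = rho (moebius z ⟨x, hx⟩) := rfl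
  have hx4 : ‖1 - conj (z : ℂ) * x‖ = kdist z ⟨x, hx⟩ := rfl
  rw [hx3, hx2, extendDisc_coe, extendDisc_mem _ hx, hx1, det_smul_one, ← mul_assoc, ← mul_assoc,
    norm_div, norm_pow, hx4, norm_neg, Complex.norm_real, Real.norm_of_nonneg (rho_pos z).le,
    rho_moebius]
  congr 1
  have h1 := rho_pos z
  have h2 := rho_pos ⟨x, hx⟩
  have h3 := kdist_pos z ⟨x, hx⟩
  -- For `α < -1` the density is nonpositive, `ENNReal.ofReal` truncates it to zero, and both sides
  -- vanish.
  by_cases hα : 0 ≤ (α + 1) / Real.pi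
  · rw [← ENNReal.ofReal_mul (by positivity), ← ENNReal.ofReal_mul (by positivity)]
    congr 1
    have e1 : rho z ^ (2 + α) = rho z ^ 2 * rho z ^ α := by
      rw [Real.rpow_add h1, Real.rpow_two]
    have e2 : kdist z ⟨x, hx⟩ ^ (-(2 * (2 + α)))
        = ((kdist z ⟨x, hx⟩ ^ 2) ^ 2 * (kdist z ⟨x, hx⟩ ^ 2) ^ α)⁻¹ := by
      rw [Real.rpow_neg h3.le, Real.rpow_mul h3.le, Real.rpow_add (by positivity), Real.rpow_two,
        Real.rpow_two]
    rw [abs_of_nonneg (by positivity), Real.div_rpow (by positivity) (by positivity),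
      Real.mul_rpow h1.le h2.le, e1, e2]
    have := Real.rpow_pos_of_pos (pow_pos h3 2) α
    field_simp
  · rw [ENNReal.ofReal_of_nonpos (p := _ / _ * _), ENNReal.ofReal_of_nonpos (p := _ / _ * _)]
    · simp
    · exact mul_nonpos_of_nonpos_of_nonneg (not_le.1 hα).le (by positivity)
    · exact mul_nonpos_of_nonpos_of_nonneg (not_le.1 hα).le (by positivity)

/-- Rotation of the disk. -/
def rot (u : Circle) (w : Disc) : Disc :=
  ⟨u * w, by
    rw [mem_ball_zero_iff, norm_mul, Circle.norm_coe, one_mul]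
    exact norm_lt_one w⟩

lemma lintegral_rot {α : ℝ} (u : Circle) (g : Disc → ℝ≥0∞) :
    ∫⁻ w, g (rot u w) ∂(dA α) = ∫⁻ w, g w ∂(dA α) := by
  rw [lintegral_dA', lintegral_dA', ← lintegral_indicator measurableSet_ball,
    ← lintegral_indicator measurableSet_ball]
  conv_rhs => rw [
    ← (LinearIsometryEquiv.measurePreserving (rotation u)).lintegral_comp_emb
      (rotation u).toMeasurableEquiv.measurableEmbedding]
  refine lintegral_congr fun x => ?_
  have hn : ‖rotation u x‖ = ‖x‖ := (rotation u).norm_map x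
  by_cases hx : x ∈ Metric.ball (0 : ℂ) 1
  · have hx' : rotation u x ∈ Metric.ball (0 : ℂ) 1 := by
      rw [mem_ball_zero_iff, hn]; exact mem_ball_zero_iff.1 hx
    rw [Set.indicator_of_mem hx, Set.indicator_of_mem hx', hn, extendDisc_mem _ hx,
      extendDisc_mem _ hx']
    rfl
  · have hx' : rotation u x ∉ Metric.ball (0 : ℂ) 1 := by
      rw [mem_ball_zero_iff, hn, ← mem_ball_zero_iff]; exact hx
    rw [Set.indicator_of_notMem hx, Set.indicator_of_notMem hx']

/-! ### Forelli–Rudin estimates for integrals of `|1 - w̄z|^(-c)`. -/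

lemma lintegral_abs_rpow_lt_top {e : ℝ} (he : e < 1) (A : ℝ) :
    ∫⁻ x in Set.Ioo (-A) A, ENNReal.ofReal |x| ^ (-e) < ∞ := by
  have hpos : ∫⁻ x in Set.Ioo 0 A, ENNReal.ofReal |x| ^ (-e) < ∞ := by
    rcases le_or_gt A 0 with hA | hA
    · simp [Set.Ioo_eq_empty_of_le hA]
    have h := (intervalIntegral.intervalIntegrable_rpow' (a := 0) (b := A)
      (by linarith : -1 < -e)).1.mono_set (Set.Ioo_subset_Ioc_self)
    refine lt_of_eq_of_lt ?_ h.2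
    refine setLIntegral_congr_fun measurableSet_Ioo fun x hx => ?_
    rw [abs_of_pos hx.1, ENNReal.ofReal_rpow_of_pos hx.1,
      Real.enorm_of_nonneg (Real.rpow_nonneg hx.1.le _)]
  have hneg : ∫⁻ x in Set.Ioo (-A) 0, ENNReal.ofReal |x| ^ (-e) < ∞ := by
    refine lt_of_eq_of_lt ?_ hpos
    rw [← lintegral_indicator measurableSet_Ioo, ← lintegral_indicator measurableSet_Ioo]
    conv_rhs => rw [
      ← (Measure.measurePreserving_neg (volume : Measure ℝ)).lintegral_comp_emb
      (MeasurableEquiv.neg ℝ).measurableEmbedding]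
    refine lintegral_congr fun x => ?_
    by_cases hx : x ∈ Set.Ioo (-A) 0
    · have hx' : -x ∈ Set.Ioo 0 A := ⟨by linarith [hx.2], by linarith [hx.1]⟩
      rw [Set.indicator_of_mem hx, Set.indicator_of_mem hx', abs_neg]
    · rw [Set.indicator_of_notMem hx, Set.indicator_of_notMem]
      exact fun h => hx ⟨by linarith [h.2], by linarith [h.1]⟩
  have hsub : Set.Ioo (-A) A ⊆ (Set.Ioo (-A) 0 ∪ {0}) ∪ Set.Ioo 0 A := by
    intro x hx
    rcases lt_trichotomy x 0 with h | h | h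
    · exact Or.inl (Or.inl ⟨hx.1, h⟩)
    · exact Or.inl (Or.inr h)
    · exact Or.inr ⟨h, hx.2⟩
  refine (lintegral_mono_set hsub).trans_lt ?_
  refine (lintegral_union_le _ _ _).trans_lt (ENNReal.add_lt_top.2 ⟨?_, hpos⟩)
  refine (lintegral_union_le _ _ _).trans_lt (ENNReal.add_lt_top.2 ⟨hneg, ?_⟩)
  rw [Measure.restrict_singleton, Real.volume_singleton, zero_smul, lintegral_zero_measure]
  exact ENNReal.zero_lt_top

/-- Jordan's inequality `|sin x| ≥ (2/π)|x|` holds for `|x| ≤ π/2`; translating by `0`, `π` or `-π`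
brings every angle in the range to this case. -/
lemma lintegral_abs_sin_rpow_lt_top {e : ℝ} (he0 : 0 ≤ e) (he : e < 1) :
    ∫⁻ θ in Set.Ioo (-Real.pi) Real.pi, ENNReal.ofReal |Real.sin θ| ^ (-e) < ∞ := by
  have hπ := Real.pi_pos
  set k : ℝ → ℝ≥0∞ := fun x => ENNReal.ofReal (2 / Real.pi) ^ (-e) * ENNReal.ofReal |x| ^ (-e)
    with hk
  have hkm : Measurable k := by fun_prop
  have hsmall : ∀ x : ℝ, |x| ≤ Real.pi / 2 → ENNReal.ofReal |Real.sin x| ^ (-e) ≤ k x := by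
    intro x hx
    have h := Real.mul_abs_le_abs_sin hx
    rw [hk]
    simp only
    rw [← ENNReal.mul_rpow_of_ne_top ENNReal.ofReal_ne_top ENNReal.ofReal_ne_top,
      ← ENNReal.ofReal_mul (by positivity), ENNReal.rpow_neg, ENNReal.rpow_neg]
    gcongr
  have hint : ∀ c : ℝ, |c| ≤ Real.pi →
      ∫⁻ θ in Set.Ioo (-Real.pi) Real.pi, k (θ + c) < ∞ := by
    intro c hc
    have hc' := abs_le.1 hc
    have h1 : ∫⁻ x in Set.Ioo (-(2 * Real.pi)) (2 * Real.pi), k x < ∞ := by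
      rw [hk, lintegral_const_mul _ (by fun_prop)]
      refine ENNReal.mul_lt_top ?_ (lintegral_abs_rpow_lt_top he _)
      rw [ENNReal.ofReal_rpow_of_pos (by positivity)]
      exact ENNReal.ofReal_lt_top
    refine lt_of_le_of_lt ?_ h1
    rw [← lintegral_indicator measurableSet_Ioo, ← lintegral_indicator measurableSet_Ioo]
    conv_rhs => rw [← lintegral_add_right_eq_self _ c]
    refine lintegral_mono fun x => ?_
    by_cases hx : x ∈ Set.Ioo (-Real.pi) Real.pi
    · rw [Set.indicator_of_mem hx, Set.indicator_of_mem]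
      exact ⟨by linarith [hx.1], by linarith [hx.2]⟩
    · rw [Set.indicator_of_notMem hx]
      exact zero_le
  calc ∫⁻ θ in Set.Ioo (-Real.pi) Real.pi, ENNReal.ofReal |Real.sin θ| ^ (-e)
      ≤ ∫⁻ θ in Set.Ioo (-Real.pi) Real.pi, (k (θ + 0) + k (θ + Real.pi) + k (θ + -Real.pi)) := by
        refine setLIntegral_mono (by fun_prop) fun θ hθ => ?_
        rcases le_or_gt |θ| (Real.pi / 2) with h | h
        · rw [add_zero]
          exact (hsmall θ h).trans (le_add_right le_self_add)
        · rcases lt_abs.1 h with h | h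
          · have h2 := hsmall (θ + -Real.pi) (by rw [abs_le]; constructor <;> linarith [hθ.2])
            rw [← sub_eq_add_neg, Real.sin_sub_pi, abs_neg, sub_eq_add_neg] at h2
            exact h2.trans le_add_self
          · have h2 := hsmall (θ + Real.pi) (by rw [abs_le]; constructor <;> linarith [hθ.1])
            rw [Real.sin_add_pi, abs_neg] at h2
            exact h2.trans (le_add_right le_add_self)
    _ < ∞ := by
        rw [lintegral_add_left (by fun_prop), lintegral_add_left (by fun_prop)]
        refine ENNReal.add_lt_top.2 ⟨ENNReal.add_lt_top.2 ⟨hint 0 ?_, hint _ ?_⟩, hint _ ?_⟩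
        · simpa using hπ.le
        · rw [abs_of_pos hπ]
        · rw [abs_neg, abs_of_pos hπ]

/-- With `z = |z|e^{iθ}`, one has `|1 - tz|² = (t|z| - cos θ)² + sin² θ`. This bound depends on the
angle only, so it separates variables in polar coordinates. -/
lemma abs_sin_arg_le_norm_one_sub (t : ℝ) (z : ℂ) : |Real.sin (Complex.arg z)| ≤ ‖1 - t * z‖ := by
  have h1 : z = (‖z‖ * Real.cos (Complex.arg z) : ℝ) + (‖z‖ * Real.sin (Complex.arg z) : ℝ) *
      Complex.I := by
    apply Complex.ext <;> simp
  rw [← abs_of_nonneg (norm_nonneg (1 - t * z)), ← sq_le_sq, ← Complex.normSq_eq_norm_sq,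
    Complex.normSq_apply]
  have hre : (1 - (t : ℂ) * z).re = 1 - t * (‖z‖ * Real.cos (Complex.arg z)) := by simp
  have him : (1 - (t : ℂ) * z).im = - (t * (‖z‖ * Real.sin (Complex.arg z))) := by simp
  rw [hre, him]
  have h2 := Real.sin_sq_add_cos_sq (Complex.arg z)
  nlinarith [sq_nonneg (t * ‖z‖ - Real.cos (Complex.arg z)), sq_nonneg (t * ‖z‖)]

/-- The Forelli–Rudin estimate in the bounded range. -/
lemma exists_lintegral_kdist_le {s c : ℝ} (hs : -1 < s) (hc : c < 2 + s) :
    ∃ B : ℝ, 0 < B ∧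
      ∀ w, ∫⁻ z, ENNReal.ofReal (kdist w z ^ (-c)) ∂(dA s) ≤ ENNReal.ofReal B := by
  rcases le_or_gt c 0 with hc0 | hc0
  · refine ⟨2 ^ (-c), by positivity, fun w => ?_⟩
    calc ∫⁻ z, ENNReal.ofReal (kdist w z ^ (-c)) ∂(dA s)
        ≤ ∫⁻ _, ENNReal.ofReal (2 ^ (-c)) ∂(dA s) :=
          lintegral_mono fun z => ENNReal.ofReal_le_ofReal
            (Real.rpow_le_rpow (kdist_pos w z).le (kdist_le_two w z) (by linarith))
      _ = _ := by rw [lintegral_const, dA_univ hs, mul_one]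
  -- Split `c = d + e`, bounding `d` powers of `kdist` below by `rho / 2` and `e` powers by `|sin
  -- θ|`. The angular integral needs `e < 1`, the radial one `s - d > -1`; `c < 2 + s` is exactly
  -- the room for both.
  obtain ⟨e, he1, he2⟩ : ∃ e, max 0 (c - 1 - s) < e ∧ e < min 1 c :=
    exists_between (max_lt (lt_min one_pos hc0) (lt_min (by linarith) (by linarith)))
  rw [max_lt_iff] at he1
  rw [lt_min_iff] at he2
  set d := c - e with hd
  have hd0 : 0 < d := by linarith
  have hsd : -1 < s - d := by linarith
  set R : ℝ → ℝ≥0∞ := fun r => ENNReal.ofReal ((s + 1) / Real.pi * 2 ^ d) *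
    ENNReal.ofReal ((1 - r ^ 2) ^ (s - d)) with hR
  set Θ : ℝ → ℝ≥0∞ := fun θ => ENNReal.ofReal |Real.sin θ| ^ (-e) with hΘ
  set T := ∫⁻ w in Metric.ball (0 : ℂ) 1, R ‖w‖ * Θ (Complex.arg w) with hT
  have hTfin : T < ∞ := by
    rw [hT, lintegral_ball_polar (by fun_prop) (by fun_prop)]
    refine ENNReal.mul_lt_top ?_ (lintegral_abs_sin_rpow_lt_top he1.1.le he2.1)
    simp_rw [hR, mul_left_comm (ENNReal.ofReal _) (ENNReal.ofReal ((s + 1) / Real.pi * 2 ^ d))]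
    rw [lintegral_const_mul _ (by fun_prop), lintegral_radial hsd]
    exact ENNReal.mul_lt_top ENNReal.ofReal_lt_top ENNReal.ofReal_lt_top
  refine ⟨T.toReal + 1, by positivity, fun w => ?_⟩
  -- By rotation invariance `w` may be taken real and nonnegative.
  obtain ⟨u, hu⟩ : ∃ u : Circle, conj (w : ℂ) * u = ‖(w : ℂ)‖ := by
    by_cases hw : (w : ℂ) = 0
    · exact ⟨1, by simp [hw]⟩
    · have hw' : (‖(w : ℂ)‖ : ℂ) ≠ 0 := by simpa using hw
      refine ⟨⟨(w : ℂ) / ‖(w : ℂ)‖, by simp [Submonoid.unitSphere, hw]⟩, ?_⟩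
      simp only
      rw [← mul_div_assoc, ← Complex.normSq_eq_conj_mul_self, Complex.normSq_eq_norm_sq]
      push_cast
      field_simp
  rw [← lintegral_rot u]
  refine le_trans ?_ ((ENNReal.ofReal_toReal hTfin.ne).symm.le.trans
    (ENNReal.ofReal_le_ofReal (by linarith)))
  rw [lintegral_dA']
  refine setLIntegral_mono' measurableSet_ball fun x hx => ?_
  set z : Disc := ⟨x, hx⟩
  have hx1 : (1 : ℝ) - ‖x‖ ^ 2 = rho z := rfl
  have hrho := rho_pos z
  have hk : kdist w (rot u z) = ‖1 - (‖(w : ℂ)‖ : ℂ) * x‖ := by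
    rw [← hu, mul_assoc]; rfl
  have hk1 : |Real.sin (Complex.arg x)| ≤ kdist w (rot u z) := by
    rw [hk]; exact abs_sin_arg_le_norm_one_sub _ _
  have hk2 : rho z / 2 ≤ kdist w (rot u z) := by
    have h := half_rho_le_kdist (rot u z) w
    rw [kdist_comm] at h
    have h' : rho (rot u z) = rho z := by
      rw [rho, rho, rot, norm_mul, Circle.norm_coe, one_mul]
    rwa [h'] at h
  have hk0 := kdist_pos w (rot u z)
  rw [extendDisc_mem _ hx, hR, hΘ]
  simp only
  rw [hx1]
  have hsplit : ENNReal.ofReal (kdist w (rot u z) ^ (-c))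
      ≤ ENNReal.ofReal ((rho z / 2) ^ (-d)) * ENNReal.ofReal |Real.sin (Complex.arg x)| ^ (-e) := by
    have : -c = -d + -e := by rw [hd]; ring
    rw [this, Real.rpow_add hk0, ENNReal.ofReal_mul (by positivity),
      ← ENNReal.ofReal_rpow_of_pos (p := -e) hk0, ENNReal.rpow_neg, ENNReal.rpow_neg]
    refine mul_le_mul' (ENNReal.ofReal_le_ofReal ?_) ?_
    · exact Real.rpow_le_rpow_of_nonpos (by positivity) hk2 (by linarith)
    · have := he1.1.le
      gcongr
  refine (mul_le_mul_right hsplit _).trans_eq ?_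
  rw [← mul_assoc]
  congr 1
  have hs1 : 0 < s + 1 := by linarith
  rw [← ENNReal.ofReal_mul (by positivity), ← ENNReal.ofReal_mul (by positivity)]
  congr 1
  rw [Real.div_rpow hrho.le (by norm_num), Real.rpow_neg (by norm_num : (0 : ℝ) ≤ 2),
    Real.rpow_sub hrho, Real.rpow_neg hrho.le]
  have := Real.rpow_pos_of_pos hrho d
  field_simp

/-- The Forelli–Rudin estimate in the range of power growth. -/
lemma exists_lintegral_kdist_le_rho {s c : ℝ} (hs : -1 < s) (hc : 2 + s < c) :
    ∃ B : ℝ, 0 < B ∧ ∀ w, ∫⁻ z, ENNReal.ofReal (kdist w z ^ (-c)) ∂(dA s)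
      ≤ ENNReal.ofReal (B * rho w ^ (2 + s - c)) := by
  -- The substitution `φ_w` replaces `kdist w z` by `rho w / kdist w z`. With the Jacobian, the
  -- exponent `c` becomes `2(2 + s) - c`, which lies in the bounded range.
  obtain ⟨B, hB, h⟩ := exists_lintegral_kdist_le (c := 2 * (2 + s) - c) hs (by linarith)
  refine ⟨B, hB, fun w => ?_⟩
  have hr := rho_pos w
  rw [← lintegral_moebius w]
  have : ∀ z, ENNReal.ofReal (rho w ^ (2 + s) * kdist w z ^ (-(2 * (2 + s)))) *
      ENNReal.ofReal (kdist w (moebius w z) ^ (-c))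
      = ENNReal.ofReal (rho w ^ (2 + s - c)) *
        ENNReal.ofReal (kdist w z ^ (-(2 * (2 + s) - c))) := by
    intro z
    have hk := kdist_pos w z
    rw [kdist_moebius, ← ENNReal.ofReal_mul (by positivity), ← ENNReal.ofReal_mul (by positivity),
      Real.div_rpow hr.le hk.le]
    congr 1
    simp only [Real.rpow_neg hk.le, Real.rpow_neg hr.le, Real.rpow_sub hk, Real.rpow_sub hr]
    have h1 := Real.rpow_pos_of_pos hk c
    have h2 := Real.rpow_pos_of_pos hr c
    field_simp
  simp_rw [this]
  rw [lintegral_const_mul' _ _ ENNReal.ofReal_ne_top, mul_comm B, ENNReal.ofReal_mul (by positivity)]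
  gcongr
  exact h w

/-- The estimate of `exists_lintegral_kdist_le`, with the weight as part of the integrand. -/
lemma exists_lintegral_rho_kdist_le {α t c : ℝ} (hα : -1 < α) (ht : -1 < α + t)
    (hc : c < 2 + α + t) :
    ∃ B : ℝ, 0 < B ∧ ∀ w, ∫⁻ z, ENNReal.ofReal (rho z ^ t * kdist w z ^ (-c)) ∂(dA α)
      ≤ ENNReal.ofReal B := by
  obtain ⟨B, hB, h⟩ := exists_lintegral_kdist_le (c := c) ht (by linarith)
  refine ⟨(α + 1) / (α + t + 1) * B, mul_pos (div_pos (by linarith) (by linarith)) hB, fun w => ?_⟩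
  have h1 := lintegral_rho_rpow_mul hα ht fun z => ENNReal.ofReal (kdist w z ^ (-c))
  simp_rw [add_sub_cancel_left, ← ENNReal.ofReal_mul (Real.rpow_nonneg (rho_pos _).le _)] at h1
  rw [h1, ENNReal.ofReal_mul (div_nonneg (by linarith) (by linarith))]
  gcongr
  exact h w

/-- The estimate of `exists_lintegral_kdist_le_rho`, with the weight as part of the integrand. -/
lemma exists_lintegral_rho_kdist_le_rho {α t c : ℝ} (hα : -1 < α) (ht : -1 < α + t)
    (hc : 2 + α + t < c) :
    ∃ B : ℝ, 0 < B ∧ ∀ w, ∫⁻ z, ENNReal.ofReal (rho z ^ t * kdist w z ^ (-c)) ∂(dA α)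
      ≤ ENNReal.ofReal (B * rho w ^ (2 + α + t - c)) := by
  obtain ⟨B, hB, h⟩ := exists_lintegral_kdist_le_rho (c := c) ht (by linarith)
  refine ⟨(α + 1) / (α + t + 1) * B, mul_pos (div_pos (by linarith) (by linarith)) hB, fun w => ?_⟩
  have h1 := lintegral_rho_rpow_mul hα ht fun z => ENNReal.ofReal (kdist w z ^ (-c))
  simp_rw [add_sub_cancel_left, ← ENNReal.ofReal_mul (Real.rpow_nonneg (rho_pos _).le _)] at h1
  rw [h1, mul_assoc, ENNReal.ofReal_mul (div_nonneg (by linarith) (by linarith)), add_assoc 2 α t]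
  gcongr
  exact h w

/-! ### Schur's test and the estimates for the integral operators. -/

/-- Schur's test for a kernel `A^(1/p) D^(1-1/p)`. -/
lemma lintegral_schur {X Y : Type*} [MeasurableSpace X] [MeasurableSpace Y] {μ : Measure X}
    {ν : Measure Y} [SFinite μ] [SFinite ν] {p : ℝ} (hp : 1 ≤ p) {f : X → ℝ≥0∞}
    {A D : X → Y → ℝ≥0∞} (hf : Measurable f) (hA : Measurable (Function.uncurry A))
    (hD : Measurable (Function.uncurry D)) {a d : ℝ≥0∞} (hAa : ∀ x, ∫⁻ y, A x y ∂ν ≤ a)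
    (hDd : ∀ y, ∫⁻ x, D x y ∂μ ≤ d) :
    ∫⁻ y, (∫⁻ x, f x * A x y ^ (1 / p) * D x y ^ (1 - 1 / p) ∂μ) ^ p ∂ν
      ≤ a * d ^ (p - 1) * ∫⁻ x, f x ^ p ∂μ := by
  have hp0 : 0 < p := by linarith
  have hp1 : 0 ≤ 1 - 1 / p := by
    rw [sub_nonneg, div_le_one hp0]; exact hp
  have hA' : ∀ y, Measurable fun x => A x y := fun y => hA.comp (measurable_id.prodMk measurable_const)
  have hD' : ∀ y, Measurable fun x => D x y := fun y => hD.comp (measurable_id.prodMk measurable_const)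
  -- Hölder's inequality in `x` for the product `(f^p A)^(1/p) D^(1-1/p)`; Tonelli's theorem then
  -- lets `A` be integrated in `y`.
  have hpt : ∀ y, (∫⁻ x, f x * A x y ^ (1 / p) * D x y ^ (1 - 1 / p) ∂μ) ^ p
      ≤ d ^ (p - 1) * ∫⁻ x, f x ^ p * A x y ∂μ := by
    intro y
    have h1 := ENNReal.lintegral_mul_norm_pow_le (μ := μ) (f := fun x => f x ^ p * A x y)
      (g := fun x => D x y) (by have := hA' y; fun_prop) (hD' y).aemeasurable
      (p := 1 / p) (q := 1 - 1 / p) (by positivity) hp1 (by ring)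
    have h2 : ∀ x, (f x ^ p * A x y) ^ (1 / p) = f x * A x y ^ (1 / p) := fun x => by
      rw [ENNReal.mul_rpow_of_nonneg _ _ (by positivity), ← ENNReal.rpow_mul,
        mul_one_div_cancel hp0.ne', ENNReal.rpow_one]
    simp_rw [h2] at h1
    calc _ ≤ ((∫⁻ x, f x ^ p * A x y ∂μ) ^ (1 / p) * (∫⁻ x, D x y ∂μ) ^ (1 - 1 / p)) ^ p := by
          gcongr
      _ = (∫⁻ x, D x y ∂μ) ^ (p - 1) * ∫⁻ x, f x ^ p * A x y ∂μ := by
          rw [ENNReal.mul_rpow_of_nonneg _ _ hp0.le, ← ENNReal.rpow_mul, ← ENNReal.rpow_mul,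
            one_div_mul_cancel hp0.ne', ENNReal.rpow_one, mul_comm]
          congr 2
          field_simp
      _ ≤ _ := by
          gcongr
          exact hDd y
  calc _ ≤ ∫⁻ y, d ^ (p - 1) * ∫⁻ x, f x ^ p * A x y ∂μ ∂ν := lintegral_mono hpt
    _ = d ^ (p - 1) * ∫⁻ y, ∫⁻ x, f x ^ p * A x y ∂μ ∂ν := by
        rw [lintegral_const_mul]
        refine Measurable.lintegral_prod_left' (f := fun q : X × Y => f q.1 ^ p * A q.1 q.2) ?_
        have : Measurable fun q : X × Y => A q.1 q.2 := hA
        fun_prop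
    _ = d ^ (p - 1) * ∫⁻ x, ∫⁻ y, f x ^ p * A x y ∂ν ∂μ := by
        rw [lintegral_lintegral_swap]
        have : Measurable fun q : Y × X => A q.2 q.1 := hA.comp measurable_swap
        refine Measurable.aemeasurable (f := fun q : Y × X => f q.2 ^ p * A q.2 q.1) ?_
        fun_prop
    _ ≤ d ^ (p - 1) * ∫⁻ x, f x ^ p * a ∂μ := by
        gcongr with x
        have hAx : Measurable (A x) := hA.comp measurable_prodMk_left
        rw [lintegral_const_mul _ hAx]
        gcongr
        exact hAa x
    _ = _ := by
        rw [lintegral_mul_const _ (by fun_prop)]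
        ring

/-- The condition on the kernel `H z w = |(S K_z)(w)|` that expresses `‖S_z 1‖_{m,α} ≤ C`. -/
def KernelBound (α m : ℝ) (C : ℝ≥0∞) (H : Disc → Disc → ℝ≥0∞) : Prop :=
  ∀ z, ∫⁻ w, H z w ^ m *
    ENNReal.ofReal (rho z ^ (2 + α) * kdist z w ^ (-((2 + α) * (2 - m)))) ∂(dA α) ≤ C ^ m

/-- Schur's test with exponent `m`, where `A` is the integrand of `KernelBound`, bounds the left
side by `∫ f^m rho^t`. Hölder's inequality with exponents `p/m` and its conjugate then brings in the
`L^p` norm of `f`. -/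
lemma exists_lintegral_kernel_le_of_lt {p m α : ℝ} (hp : 1 < p) (hα : -1 < α)
    (hm : p * (2 + α) / ((p - 1) * (1 + α)) < m) (hmp : m < p) :
    ∃ K : ℝ≥0∞, K ≠ ∞ ∧ ∀ (H : Disc → Disc → ℝ≥0∞), Measurable (Function.uncurry H) →
      ∀ C : ℝ≥0∞, KernelBound α m C H → ∀ f : Disc → ℝ≥0∞, Measurable f →
        ∫⁻ w, (∫⁻ z, f z * H z w ∂(dA α)) ^ m ∂(dA α)
          ≤ K * C ^ m * (∫⁻ z, f z ^ p ∂(dA α)) ^ (m / p) := by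
  have := isProbabilityMeasure_dA hα
  have hb : 0 < 1 + α := by linarith
  have hp1 : 0 < p - 1 := by linarith
  have hp0 : 0 < p := by linarith
  have hm' : p * (2 + α) < m * ((p - 1) * (1 + α)) := (div_lt_iff₀ (by positivity)).1 hm
  have hm1 : 1 < m := by
    refine lt_trans ?_ hm
    rw [lt_div_iff₀ (by positivity)]
    nlinarith
  have hm0 : 0 < m := by linarith
  have hm10 : 0 < m - 1 := by linarith
  have hpm : 0 < p - m := by linarith
  -- The lower bound makes `rho ^ (t / (1 - m/p))` integrable. Of the upper bounds, `t < 0` puts the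
  -- Schur integral of `D` in the bounded range and the other makes its weight integrable. The
  -- interval is nonempty precisely by the lower bound on `m`.
  obtain ⟨t, ht1, ht2⟩ : ∃ t, -((1 + α) * (1 - m / p)) < t ∧
      t < min 0 ((1 + α) * (m - 1) - (2 + α)) := by
    refine exists_between (lt_min ?_ ?_)
    · rw [neg_lt_zero]
      exact mul_pos hb (by rw [sub_pos, div_lt_one hp0]; exact hmp)
    · rw [← sub_pos]
      have : (1 + α) * (m - 1) - (2 + α) - -((1 + α) * (1 - m / p))
          = (m * ((p - 1) * (1 + α)) - p * (2 + α)) / p := by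
        field_simp; ring
      rw [this]
      exact div_pos (by linarith) hp0
  rw [lt_min_iff] at ht2
  obtain ⟨B, hB, hFR⟩ := exists_lintegral_rho_kdist_le (α := α) (t := -((2 + α + t) / (m - 1)))
    (c := (2 + α) * (m - 2) / (m - 1)) hα
    (by
      have : (2 + α + t) / (m - 1) < 1 + α := by
        rw [div_lt_iff₀ hm10]; linarith
      linarith)
    (by
      rw [← sub_pos]
      have : 2 + α + -((2 + α + t) / (m - 1)) - (2 + α) * (m - 2) / (m - 1) = -t / (m - 1) := by
        field_simp; ring
      rw [this]
      exact div_pos (by linarith) hm10)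
  -- With `c = 0` this is only the finiteness of the integral of a power of `rho`.
  obtain ⟨B', hB', hFR'⟩ := exists_lintegral_rho_kdist_le (α := α) (t := t / (1 - m / p))
    (c := 0) hα
    (by
      have : 0 < 1 - m / p := by rw [sub_pos, div_lt_one hp0]; exact hmp
      have : -(1 + α) < t / (1 - m / p) := by
        rw [lt_div_iff₀ this]; linarith
      linarith)
    (by
      have : 0 < 1 - m / p := by rw [sub_pos, div_lt_one hp0]; exact hmp
      have : -(1 + α) < t / (1 - m / p) := by
        rw [lt_div_iff₀ this]; linarith
      linarith)
  have hmp1 : 0 < 1 - m / p := by rw [sub_pos, div_lt_one hp0]; exact hmp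
  refine ⟨ENNReal.ofReal B ^ (m - 1) * ENNReal.ofReal B' ^ (1 - m / p), ?_, ?_⟩
  · exact ENNReal.mul_ne_top (ENNReal.rpow_ne_top_of_nonneg hm10.le ENNReal.ofReal_ne_top)
      (ENNReal.rpow_ne_top_of_nonneg hmp1.le ENNReal.ofReal_ne_top)
  intro H hH C hC f hf
  have hH' : Measurable fun q : Disc × Disc => H q.1 q.2 := hH
  have hS := lintegral_schur (μ := dA α) (ν := dA α) hm1.le
    (f := fun z => f z * ENNReal.ofReal (rho z ^ (t / m)))
    (A := fun z w => H z w ^ m *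
      ENNReal.ofReal (rho z ^ (2 + α) * kdist z w ^ (-((2 + α) * (2 - m)))))
    (D := fun z w => ENNReal.ofReal (rho z ^ (-((2 + α + t) / (m - 1))) *
      kdist z w ^ (-((2 + α) * (m - 2) / (m - 1)))))
    (by fun_prop) (by unfold Function.uncurry; fun_prop) (by unfold Function.uncurry; fun_prop)
    hC (fun w => by simp_rw [kdist_comm _ w]; exact hFR w)
  have hid : ∀ z w, f z * ENNReal.ofReal (rho z ^ (t / m)) * (H z w ^ m *
      ENNReal.ofReal (rho z ^ (2 + α) * kdist z w ^ (-((2 + α) * (2 - m))))) ^ (1 / m) *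
      ENNReal.ofReal (rho z ^ (-((2 + α + t) / (m - 1))) *
      kdist z w ^ (-((2 + α) * (m - 2) / (m - 1)))) ^ (1 - 1 / m) = f z * H z w := by
    intro z w
    have h1 := rho_pos z
    have h2 := kdist_pos z w
    rw [ENNReal.mul_rpow_of_nonneg _ _ (by positivity), ← ENNReal.rpow_mul,
      mul_one_div_cancel hm0.ne', ENNReal.rpow_one, ENNReal.ofReal_rpow_of_pos (by positivity),
      ENNReal.ofReal_rpow_of_pos (by positivity)]
    have h3 : ∀ a b c : ℝ≥0∞, f z * a * (H z w * b) * c = f z * H z w * (a * b * c) := by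
      intros; ring
    rw [h3, ← ENNReal.ofReal_mul (by positivity), ← ENNReal.ofReal_mul (by positivity)]
    convert mul_one _
    rw [← ENNReal.ofReal_one]
    congr 1
    generalize rho z = x at h1
    generalize kdist z w = y at h2
    -- Writing the positive quantities as exponentials turns an identity between real powers into a
    -- polynomial identity between exponents.
    obtain ⟨x, rfl⟩ : ∃ u, x = Real.exp u := ⟨Real.log x, (Real.exp_log h1).symm⟩
    obtain ⟨y, rfl⟩ : ∃ u, y = Real.exp u := ⟨Real.log y, (Real.exp_log h2).symm⟩
    simp only [← Real.exp_mul, ← Real.exp_add]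
    rw [Real.exp_eq_one_iff]
    field_simp
    ring
  simp_rw [hid] at hS
  refine hS.trans ?_
  have hfin : ∫⁻ z, (f z * ENNReal.ofReal (rho z ^ (t / m))) ^ m ∂(dA α)
      ≤ (∫⁻ z, f z ^ p ∂(dA α)) ^ (m / p) * ENNReal.ofReal B' ^ (1 - m / p) := by
    have h1 := ENNReal.lintegral_mul_norm_pow_le (μ := dA α) (f := fun z => f z ^ p)
      (g := fun z => ENNReal.ofReal (rho z ^ (t / (1 - m / p)))) (by fun_prop) (by fun_prop)
      (p := m / p) (q := 1 - m / p) (by positivity) hmp1.le (by ring)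
    have h2 : ∫⁻ z, ENNReal.ofReal (rho z ^ (t / (1 - m / p))) ∂(dA α) ≤ ENNReal.ofReal B' := by
      simpa using hFR' ⟨0, by simp⟩
    calc _ = ∫⁻ z, (f z ^ p) ^ (m / p) *
          ENNReal.ofReal (rho z ^ (t / (1 - m / p))) ^ (1 - m / p) ∂(dA α) := by
          refine lintegral_congr fun z => ?_
          have h3 := rho_pos z
          rw [ENNReal.mul_rpow_of_nonneg _ _ hm0.le, ← ENNReal.rpow_mul,
            ENNReal.ofReal_rpow_of_pos (by positivity), ENNReal.ofReal_rpow_of_pos (by positivity),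
            ← Real.rpow_mul h3.le, ← Real.rpow_mul h3.le, div_mul_cancel₀ _ hm0.ne',
            div_mul_cancel₀ _ hmp1.ne', mul_div_cancel₀ _ hp0.ne']
      _ ≤ _ := h1.trans (by gcongr)
  calc _ ≤ C ^ m * ENNReal.ofReal B ^ (m - 1) *
        ((∫⁻ z, f z ^ p ∂(dA α)) ^ (m / p) * ENNReal.ofReal B' ^ (1 - m / p)) := by gcongr
    _ = _ := by ring

/-- Schur's test with exponent `p`. Since `p < m`, the bound on the `m`-th powers is lowered to
exponent `p` by Hölder's inequality in `w` against an auxiliary kernel `V`, whose `w`-integral is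
bounded uniformly in `z`; the second Schur kernel compensates the powers so introduced. -/
lemma exists_lintegral_kernel_le_of_gt {p m α : ℝ} (hp : 1 < p) (hα : -1 < α)
    (hm : p * (2 + α) / ((p - 1) * (1 + α)) < m) (hpm : p < m) :
    ∃ K : ℝ≥0∞, K ≠ ∞ ∧ ∀ (H : Disc → Disc → ℝ≥0∞), Measurable (Function.uncurry H) →
      ∀ C : ℝ≥0∞, KernelBound α m C H → ∀ f : Disc → ℝ≥0∞, Measurable f →
        ∫⁻ w, (∫⁻ z, f z * H z w ∂(dA α)) ^ p ∂(dA α)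
          ≤ K * C ^ p * ∫⁻ z, f z ^ p ∂(dA α) := by
  have := isProbabilityMeasure_dA hα
  have hb : 0 < 1 + α := by linarith
  have ha : 0 < 2 + α := by linarith
  have hp1 : 0 < p - 1 := by linarith
  have hp0 : 0 < p := by linarith
  have hm' : p * (2 + α) < m * ((p - 1) * (1 + α)) := (div_lt_iff₀ (by positivity)).1 hm
  have hm1 : 1 < m := by linarith
  have hm0 : 0 < m := by linarith
  have hm10 : 0 < m - 1 := by linarith
  -- The exponents defined below are forced: `σ`, `c` and `τ` make the powers of `rho w`, `kdist`
  -- and `rho z` cancel in `A^(1/p) D^(1-1/p)`, and `x` makes the growth of the integral of `V`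
  -- cancel its factor `rho z ^ y`. Only `y` is free.
  have hpm0 : 0 < 1 - p / m := by rw [sub_pos, div_lt_one hm0]; exact hpm
  set σ := (1 - p / m) / (p - 1) with hσ
  have hσ0 : 0 < σ := div_pos hpm0 hp1
  have hg1 : 0 < (1 + α) - (2 + α) / (m - 1) := by
    rw [sub_pos, div_lt_iff₀ hm10]
    by_contra hcon
    rw [not_lt] at hcon
    nlinarith [mul_le_mul_of_nonneg_left hcon hp0.le, mul_lt_mul_of_pos_left hpm hb]
  have hg2 : 0 < (1 + α) - (2 + α) * p / ((p - 1) * m) := by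
    rw [sub_pos, div_lt_iff₀ (by positivity)]
    nlinarith
  -- The two bounds say that the weights `rho ^ (-x)` and `rho ^ τ` are integrable; `y > 0` puts
  -- both integrals in the range of power growth.
  obtain ⟨y, hy0, hy⟩ : ∃ y, 0 < y ∧ y < min ((1 + α) - (2 + α) / (m - 1))
      (((1 + α) - (2 + α) * p / ((p - 1) * m)) / σ) :=
    exists_between (lt_min hg1 (div_pos hg2 hσ0))
  rw [lt_min_iff, lt_div_iff₀ hσ0] at hy
  set x := y + (2 + α) / (m - 1) with hx
  have hx0 : 0 < x := add_pos hy0 (div_pos ha hm10)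
  set c := (2 + α) * (m - 2) / (m - 1) with hc
  have hcy : 2 + α + -x - c = -y := by
    rw [hx, hc]; field_simp; ring
  set τ := -((2 + α) * p / ((p - 1) * m) + y * σ) with hτ
  have hcτ : 2 + α + τ - c = -(x * σ) := by
    rw [hτ, hx, hc, hσ]; field_simp; ring
  obtain ⟨B, hB, hFR⟩ := exists_lintegral_rho_kdist_le_rho (α := α) (t := -x) (c := c) hα
    (by linarith [hy.1]) (by linarith)
  obtain ⟨B', hB', hFR'⟩ := exists_lintegral_rho_kdist_le_rho (α := α) (t := τ) (c := c) hα
    (by linarith [hy.2]) (by nlinarith)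
  refine ⟨ENNReal.ofReal B ^ (1 - p / m) * ENNReal.ofReal B' ^ (p - 1), ?_, ?_⟩
  · exact ENNReal.mul_ne_top (ENNReal.rpow_ne_top_of_nonneg hpm0.le ENNReal.ofReal_ne_top)
      (ENNReal.rpow_ne_top_of_nonneg hp1.le ENNReal.ofReal_ne_top)
  intro H hH C hC f hf
  have hH' : Measurable fun q : Disc × Disc => H q.1 q.2 := hH
  set G : Disc → Disc → ℝ≥0∞ := fun z w => H z w ^ m *
      ENNReal.ofReal (rho z ^ (2 + α) * kdist z w ^ (-((2 + α) * (2 - m)))) with hG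
  set V : Disc → Disc → ℝ≥0∞ := fun z w =>
    ENNReal.ofReal (rho z ^ y * (rho w ^ (-x) * kdist z w ^ (-c))) with hV
  have hGm : Measurable fun q : Disc × Disc => G q.1 q.2 := by fun_prop
  have hVm : Measurable fun q : Disc × Disc => V q.1 q.2 := by fun_prop
  have hVB : ∀ z, ∫⁻ w, V z w ∂(dA α) ≤ ENNReal.ofReal B := by
    intro z
    have h1 := rho_pos z
    simp_rw [hV, ENNReal.ofReal_mul (Real.rpow_nonneg h1.le y)]
    rw [lintegral_const_mul' _ _ ENNReal.ofReal_ne_top]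
    refine (mul_le_mul_right (hFR z) _).trans_eq ?_
    rw [hcy, ← ENNReal.ofReal_mul (by positivity), mul_left_comm, ← Real.rpow_add h1,
      add_neg_cancel, Real.rpow_zero, mul_one]
  have hDB : ∀ w, ∫⁻ z, ENNReal.ofReal (rho w ^ (x * σ) * (rho z ^ τ * kdist z w ^ (-c))) ∂(dA α)
      ≤ ENNReal.ofReal B' := by
    intro w
    have h1 := rho_pos w
    simp_rw [ENNReal.ofReal_mul (Real.rpow_nonneg h1.le (x * σ)), kdist_comm _ w]
    rw [lintegral_const_mul' _ _ ENNReal.ofReal_ne_top]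
    refine (mul_le_mul_right (hFR' w) _).trans_eq ?_
    rw [hcτ, ← ENNReal.ofReal_mul (by positivity), mul_left_comm, ← Real.rpow_add h1,
      add_neg_cancel, Real.rpow_zero, mul_one]
  have hAB : ∀ z, ∫⁻ w, G z w ^ (p / m) * V z w ^ (1 - p / m) ∂(dA α)
      ≤ C ^ p * ENNReal.ofReal B ^ (1 - p / m) := by
    intro z
    refine (ENNReal.lintegral_mul_norm_pow_le
      (hGm.comp measurable_prodMk_left).aemeasurable (hVm.comp measurable_prodMk_left).aemeasurable
      (by positivity) hpm0.le (by ring)).trans ?_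
    have h1 : C ^ p = (C ^ m) ^ (p / m) := by
      rw [← ENNReal.rpow_mul, mul_div_cancel₀ _ hm0.ne']
    rw [h1]
    gcongr
    · exact hC z
    · exact hVB z
  have hS := lintegral_schur (μ := dA α) (ν := dA α) hp.le (f := f)
    (A := fun z w => G z w ^ (p / m) * V z w ^ (1 - p / m))
    (D := fun z w => ENNReal.ofReal (rho w ^ (x * σ) * (rho z ^ τ * kdist z w ^ (-c))))
    hf (by unfold Function.uncurry; fun_prop) (by unfold Function.uncurry; fun_prop) hAB hDB
  have hid : ∀ z w, f z * (G z w ^ (p / m) * V z w ^ (1 - p / m)) ^ (1 / p) *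
      ENNReal.ofReal (rho w ^ (x * σ) * (rho z ^ τ * kdist z w ^ (-c))) ^ (1 - 1 / p)
      = f z * H z w := by
    intro z w
    have h1 := rho_pos z
    have h2 := kdist_pos z w
    have h3 := rho_pos w
    have e1 : m * (p / m * (1 / p)) = 1 := by field_simp
    rw [ENNReal.mul_rpow_of_nonneg _ _ (by positivity), ← ENNReal.rpow_mul, ← ENNReal.rpow_mul, hG,
      hV]
    simp only
    rw [ENNReal.mul_rpow_of_nonneg _ _ (by positivity), ← ENNReal.rpow_mul, e1, ENNReal.rpow_one,
      ENNReal.ofReal_rpow_of_pos (by positivity),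
      ENNReal.ofReal_rpow_of_pos (by positivity), ENNReal.ofReal_rpow_of_pos (by positivity)]
    have h4 : ∀ a b c : ℝ≥0∞, f z * (H z w * a * b) * c = f z * H z w * (a * b * c) := by
      intros; ring
    rw [h4, ← ENNReal.ofReal_mul (by positivity), ← ENNReal.ofReal_mul (by positivity)]
    convert mul_one _
    rw [← ENNReal.ofReal_one]
    congr 1
    generalize rho z = r at h1
    generalize rho w = r' at h3
    generalize kdist z w = k at h2
    obtain ⟨r, rfl⟩ : ∃ u, r = Real.exp u := ⟨Real.log r, (Real.exp_log h1).symm⟩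
    obtain ⟨k, rfl⟩ : ∃ u, k = Real.exp u := ⟨Real.log k, (Real.exp_log h2).symm⟩
    obtain ⟨r', rfl⟩ : ∃ u, r' = Real.exp u := ⟨Real.log r', (Real.exp_log h3).symm⟩
    simp only [← Real.exp_mul, ← Real.exp_add]
    rw [Real.exp_eq_one_iff, hτ, hσ, hc]
    field_simp
    ring
  simp_rw [hid] at hS
  refine hS.trans_eq ?_
  ring

/-- The Bergman projection with the modulus of the kernel is bounded on `L^p`. -/
lemma exists_lintegral_bergman_le {p α : ℝ} (hp : 1 < p) (hα : -1 < α) :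
    ∃ K : ℝ≥0∞, K ≠ ∞ ∧ ∀ f : Disc → ℝ≥0∞, Measurable f →
      ∫⁻ w, (∫⁻ z, f z * ENNReal.ofReal (kdist z w ^ (-(2 + α))) ∂(dA α)) ^ p ∂(dA α)
        ≤ K * ∫⁻ z, f z ^ p ∂(dA α) := by
  have := isProbabilityMeasure_dA hα
  have hb : 0 < 1 + α := by linarith
  have hp1 : 0 < p - 1 := by linarith
  have hp0 : 0 < p := by linarith
  -- The classical Schur test function is `rho ^ (-δ)`; its powers with exponent `p` and with the
  -- conjugate exponent must both be integrable.
  obtain ⟨δ, hδ0, hδ⟩ : ∃ δ, 0 < δ ∧ δ < min ((1 + α) / p) ((1 + α) / (p / (p - 1))) :=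
    exists_between (lt_min (by positivity) (by positivity))
  rw [lt_min_iff, lt_div_iff₀ (by positivity), lt_div_iff₀ (by positivity)] at hδ
  have hq : 0 < δ * (p / (p - 1)) := by positivity
  have hq' : 0 < δ * p := by positivity
  obtain ⟨B, hB, hFR⟩ := exists_lintegral_rho_kdist_le_rho (α := α) (t := -(δ * p)) (c := 2 + α) hα
    (by linarith) (by linarith)
  obtain ⟨B', hB', hFR'⟩ := exists_lintegral_rho_kdist_le_rho (α := α) (t := -(δ * (p / (p - 1))))
    (c := 2 + α) hα (by linarith) (by linarith)
  refine ⟨ENNReal.ofReal B * ENNReal.ofReal B' ^ (p - 1), ENNReal.mul_ne_top ENNReal.ofReal_ne_top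
    (ENNReal.rpow_ne_top_of_nonneg hp1.le ENNReal.ofReal_ne_top), fun f hf => ?_⟩
  have hAB : ∀ t B, 0 < B →
      (∀ w, ∫⁻ z, ENNReal.ofReal (rho z ^ (-t) * kdist w z ^ (-(2 + α))) ∂(dA α)
      ≤ ENNReal.ofReal (B * rho w ^ (2 + α + -t - (2 + α)))) →
      ∀ z, ∫⁻ w, ENNReal.ofReal (rho z ^ t * (rho w ^ (-t) * kdist z w ^ (-(2 + α)))) ∂(dA α)
      ≤ ENNReal.ofReal B := by
    intro t B hB h z
    have h1 := rho_pos z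
    simp_rw [ENNReal.ofReal_mul (Real.rpow_nonneg h1.le t)]
    rw [lintegral_const_mul' _ _ ENNReal.ofReal_ne_top]
    refine (mul_le_mul_right (h z) _).trans_eq ?_
    rw [← ENNReal.ofReal_mul (by positivity), mul_left_comm, ← Real.rpow_add h1]
    have : t + (2 + α + -t - (2 + α)) = 0 := by ring
    rw [this, Real.rpow_zero, mul_one]
  have hS := lintegral_schur (μ := dA α) (ν := dA α) hp.le (f := f)
    (A := fun z w => ENNReal.ofReal (rho z ^ (δ * p) *
      (rho w ^ (-(δ * p)) * kdist z w ^ (-(2 + α)))))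
    (D := fun z w => ENNReal.ofReal (rho w ^ (δ * (p / (p - 1))) *
      (rho z ^ (-(δ * (p / (p - 1)))) * kdist w z ^ (-(2 + α)))))
    hf (by unfold Function.uncurry; fun_prop) (by unfold Function.uncurry; fun_prop)
    (hAB _ B hB hFR) (hAB _ B' hB' hFR')
  refine le_trans (le_of_eq ?_) hS
  refine lintegral_congr fun w => ?_
  congr 1
  refine lintegral_congr fun z => ?_
  have h1 := rho_pos z
  have h2 := kdist_pos z w
  have h3 := rho_pos w
  rw [mul_assoc]
  congr 1
  rw [kdist_comm w z, ENNReal.ofReal_rpow_of_pos (by positivity),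
    ENNReal.ofReal_rpow_of_pos (by positivity), ← ENNReal.ofReal_mul (by positivity)]
  congr 1
  generalize rho z = r at h1
  generalize rho w = r' at h3
  generalize kdist z w = k at h2
  obtain ⟨r, rfl⟩ : ∃ u, r = Real.exp u := ⟨Real.log r, (Real.exp_log h1).symm⟩
  obtain ⟨k, rfl⟩ : ∃ u, k = Real.exp u := ⟨Real.log k, (Real.exp_log h2).symm⟩
  obtain ⟨r', rfl⟩ : ∃ u, r' = Real.exp u := ⟨Real.log r', (Real.exp_log h3).symm⟩
  simp only [← Real.exp_mul, ← Real.exp_add]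
  congr 1
  field_simp
  ring

/-! ### Analytic functions: mean value property, reproducing formula, Bergman projection. -/

/-- A function on the disk that is the restriction of a function holomorphic there. -/
def IsAnalytic (f : Disc → ℂ) : Prop :=
  ∃ F : ℂ → ℂ, DifferentiableOn ℂ F (Metric.ball 0 1) ∧ ∀ w : Disc, f w = F w

lemma IsAnalytic.continuous {f : Disc → ℂ} (hf : IsAnalytic f) : Continuous f := by
  obtain ⟨F, hF, hfF⟩ := hf
  have : f = fun w : Disc => F w := funext hfF
  rw [this]
  exact hF.continuousOn.comp_continuous continuous_subtype_val fun w => w.2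

lemma IsAnalytic.mul {f g : Disc → ℂ} (hf : IsAnalytic f) (hg : IsAnalytic g) :
    IsAnalytic fun w => f w * g w := by
  obtain ⟨F, hF, hfF⟩ := hf
  obtain ⟨G, hG, hgG⟩ := hg
  exact ⟨F * G, hF.mul hG, fun w => by simp [hfF, hgG]⟩

lemma IsAnalytic.sub {f g : Disc → ℂ} (hf : IsAnalytic f) (hg : IsAnalytic g) :
    IsAnalytic fun w => f w - g w := by
  obtain ⟨F, hF, hfF⟩ := hf
  obtain ⟨G, hG, hgG⟩ := hg
  exact ⟨F - G, hF.sub hG, fun w => by simp [hfF, hgG]⟩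

lemma one_sub_mem_slitPlane (z w : Disc) : 1 - conj (z : ℂ) * w ∈ Complex.slitPlane := by
  left
  have h1 : (conj (z : ℂ) * w).re ≤ ‖conj (z : ℂ) * w‖ := Complex.re_le_norm _
  rw [norm_mul, Complex.norm_conj] at h1
  rw [Complex.sub_re, Complex.one_re]
  nlinarith [norm_nonneg (z : ℂ), norm_lt_one w, norm_lt_one z]

lemma cpow_real_ne_zero {x : ℂ} (hx : x ≠ 0) (b : ℝ) : x ^ (b : ℂ) ≠ 0 := by
  rw [← norm_pos_iff, Complex.norm_cpow_real]
  exact Real.rpow_pos_of_pos (norm_pos_iff.2 hx) b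

lemma isAnalytic_kernel (α : ℝ) (z : Disc) : IsAnalytic (kernel α z) := by
  refine ⟨fun x => 1 / (1 - conj (z : ℂ) * x) ^ ((2 + α : ℝ) : ℂ), fun x hx => ?_, fun w => rfl⟩
  have hs : 1 - conj (z : ℂ) * x ∈ Complex.slitPlane := one_sub_mem_slitPlane z ⟨x, hx⟩
  refine DifferentiableAt.differentiableWithinAt (DifferentiableAt.div (by fun_prop) ?_ ?_)
  · exact DifferentiableAt.cpow_const (by fun_prop) hs
  · exact cpow_real_ne_zero (Complex.slitPlane_ne_zero hs) _

lemma IsAnalytic.comp_moebius {f : Disc → ℂ} (hf : IsAnalytic f) (z : Disc) :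
    IsAnalytic fun w => f (moebius z w) := by
  obtain ⟨F, hF, hfF⟩ := hf
  refine ⟨fun x => F (((z : ℂ) - x) / (1 - conj (z : ℂ) * x)), ?_, fun w => hfF _⟩
  refine hF.comp (fun x hx => ?_) fun x hx => moebius_mem z ⟨x, hx⟩
  exact (hasDerivAt_moebius z ⟨x, hx⟩).differentiableAt.differentiableWithinAt

lemma continuous_kernel (α : ℝ) : Continuous fun x : Disc × Disc => kernel α x.1 x.2 := by
  unfold kernel
  have h : Continuous fun x : Disc × Disc => conj (x.1 : ℂ) :=
    Complex.continuous_conj.comp (by fun_prop)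
  refine Continuous.div continuous_const ?_ fun x => ?_
  · refine Continuous.cpow (by fun_prop) continuous_const fun x => one_sub_mem_slitPlane x.1 x.2
  · exact cpow_real_ne_zero (one_sub_ne_zero x.1 x.2) _

lemma continuous_kernel_left (α : ℝ) (w : Disc) : Continuous fun z => kernel α z w := by
  have h := (continuous_kernel α).comp (Continuous.prodMk_left w)
  exact h

lemma enorm_kernel (α : ℝ) (z w : Disc) :
    ‖kernel α z w‖ₑ = ENNReal.ofReal (kdist z w ^ (-(2 + α))) := by
  rw [← ofReal_norm, norm_kernel]

lemma norm_kernel_le {α : ℝ} (hα : -1 < α) (z w : Disc) :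
    ‖kernel α z w‖ ≤ (rho w / 2) ^ (-(2 + α)) := by
  rw [norm_kernel, kdist_comm]
  exact Real.rpow_le_rpow_of_nonpos (by linarith [rho_pos w]) (half_rho_le_kdist w z) (by linarith)

lemma measurePreserving_rot (α : ℝ) (u : Circle) : MeasurePreserving (rot u) (dA α) (dA α) := by
  have hm : Measurable (rot u) :=
    (Continuous.subtype_mk (by fun_prop) _ : Continuous (rot u)).measurable
  refine ⟨hm, Measure.ext_of_lintegral _ fun g hg => ?_⟩
  rw [lintegral_map hg hm, lintegral_rot]

lemma map_moebius (α : ℝ) (z : Disc) : Measure.map (moebius z) ((dA α).withDensity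
    fun w => ENNReal.ofReal (rho z ^ (2 + α) * kdist z w ^ (-(2 * (2 + α))))) = dA α := by
  refine Measure.ext_of_lintegral _ fun g hg => ?_
  have hm := (continuous_moebius z).measurable
  rw [lintegral_map hg hm, lintegral_withDensity_eq_lintegral_mul _ (by fun_prop) (by fun_prop),
    ← lintegral_moebius z g]
  rfl

lemma integral_moebius {α : ℝ} (z : Disc) {f : Disc → ℂ} (hf : Continuous f) :
    ∫ w, (rho z ^ (2 + α) * kdist z w ^ (-(2 * (2 + α)))) • f (moebius z w) ∂(dA α)
      = ∫ w, f w ∂(dA α) := by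
  conv_rhs => rw [← map_moebius α z]
  have h1 := rho_pos z
  rw [integral_map (continuous_moebius z).aemeasurable hf.aestronglyMeasurable,
    integral_withDensity_eq_integral_toReal_smul (by fun_prop)
    (ae_of_all _ fun _ => ENNReal.ofReal_lt_top)]
  refine integral_congr_ae (ae_of_all _ fun w => ?_)
  have h2 := kdist_pos z w
  simp only
  rw [ENNReal.toReal_ofReal (by positivity)]

/-- The mean value property. -/
lemma IsAnalytic.integral_eq {α : ℝ} (hα : -1 < α) {f : Disc → ℂ} (hf : IsAnalytic f)
    (hi : Integrable f (dA α)) : ∫ w, f w ∂(dA α) = f ⟨0, by simp⟩ := by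
  have := isProbabilityMeasure_dA hα
  have hpi := Real.pi_pos
  have hrotc : Continuous fun x : ℝ × Disc => rot (Circle.exp x.1) x.2 := by
    refine Continuous.subtype_mk ?_ _
    have : Continuous fun x : ℝ × Disc => ((Circle.exp x.1 : Circle) : ℂ) :=
      continuous_subtype_val.comp (Circle.exp.continuous.comp continuous_fst)
    fun_prop
  set I : Set ℝ := Set.Ioc 0 (2 * Real.pi) with hI
  have hint : Integrable (Function.uncurry fun (θ : ℝ) w => f (rot (Circle.exp θ) w))
      ((volume.restrict I).prod (dA α)) := by
    have hm : AEStronglyMeasurable (Function.uncurry fun (θ : ℝ) w => f (rot (Circle.exp θ) w))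
        ((volume.restrict I).prod (dA α)) :=
      (hf.continuous.comp hrotc).aestronglyMeasurable
    rw [integrable_prod_iff hm]
    refine ⟨ae_of_all _ fun θ => ?_, ?_⟩
    · exact (measurePreserving_rot α (Circle.exp θ)).integrable_comp_of_integrable hi
    · have : ∀ θ : ℝ, ∫ w, ‖f (rot (Circle.exp θ) w)‖ ∂(dA α) = ∫ w, ‖f w‖ ∂(dA α) := by
        intro θ
        have h := measurePreserving_rot α (Circle.exp θ)
        conv_rhs => rw [← h.map_eq]
        rw [integral_map h.measurable.aemeasurable hf.continuous.norm.aestronglyMeasurable]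
      simp only [Function.uncurry_apply_pair, this]
      exact integrable_const _
  -- Average `f` over all rotations: rotation invariance makes one iterated integral `2π ∫ f`, and
  -- Cauchy's mean value property on each circle makes the other `2π f(0)`.
  have hswap := integral_integral_swap hint
  have hl : ∀ θ : ℝ, ∫ w, f (rot (Circle.exp θ) w) ∂(dA α) = ∫ w, f w ∂(dA α) := by
    intro θ
    have h := measurePreserving_rot α (Circle.exp θ)
    conv_rhs => rw [← h.map_eq]
    rw [integral_map h.measurable.aemeasurable hf.continuous.aestronglyMeasurable]
  have hr : ∀ w : Disc, ∫ θ in I, f (rot (Circle.exp θ) w) = (2 * Real.pi) • f ⟨0, by simp⟩ := by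
    intro w
    obtain ⟨F, hF, hfF⟩ := hf
    have hd : DiffContOnCl ℂ (fun ζ : ℂ => F (ζ * w)) (Metric.ball 0 |1|) := by
      rw [abs_one]
      refine DifferentiableOn.diffContOnCl ?_
      rw [closure_ball _ one_ne_zero]
      refine hF.comp (by fun_prop) fun ζ hζ => ?_
      rw [mem_closedBall_zero_iff] at hζ
      rw [mem_ball_zero_iff, norm_mul]
      nlinarith [norm_nonneg (w : ℂ), norm_lt_one w, norm_nonneg ζ]
    have h := hd.circleAverage
    rw [Real.circleAverage_def, inv_smul_eq_iff₀ (by positivity),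
      intervalIntegral.integral_of_le (by positivity)] at h
    rw [hfF, hI]
    simp only [zero_mul] at h
    rw [← h]
    refine setIntegral_congr_fun measurableSet_Ioc fun θ _ => ?_
    rw [hfF]
    simp [rot, circleMap]
  simp_rw [hl, hr] at hswap
  rw [integral_const, integral_const] at hswap
  simp only [measureReal_restrict_apply_univ, probReal_univ, one_smul] at hswap
  rw [hI, Real.volume_real_Ioc_of_le (by positivity), sub_zero] at hswap
  exact smul_right_injective ℂ (by positivity : (2 * Real.pi) ≠ 0) hswap

/-- With `ζ = 1 - w̄u`, the base of the kernel on the left is `rho w / conj ζ`, and `|ζ|² = ζ conj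
ζ`. The principal powers multiply correctly because `Re ζ > 0`. The effect is that `φ_w` turns the
integrand of the reproducing formula into an analytic function of `u`. -/
lemma kernel_moebius (α : ℝ) (w u : Disc) :
    (rho w ^ (2 + α) * kdist w u ^ (-(2 * (2 + α)))) • kernel α (moebius w u) w
      = kernel α w u := by
  have hζ := one_sub_mem_slitPlane w u
  have hk : kdist w u = ‖1 - conj (w : ℂ) * u‖ := rfl
  have hr := rho_pos w
  have h1 : 1 - conj (moebius w u : ℂ) * w = (rho w : ℂ) * (conj (1 - conj (w : ℂ) * u))⁻¹ := by
    have h := congrArg conj (one_sub_conj_mul_moebius w u)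
    rw [map_div₀, Complex.conj_ofReal, div_eq_mul_inv] at h
    rw [← h]
    simp [mul_comm]
  rw [kernel, kernel, h1, hk]
  generalize 1 - conj (w : ℂ) * u = ζ at hζ
  have hζ0 := Complex.slitPlane_ne_zero hζ
  have hc0 : conj ζ ≠ 0 := (map_ne_zero _).2 hζ0
  have harg := Complex.slitPlane_arg_ne_pi hζ
  have harg' : (conj ζ).arg ≠ Real.pi := by
    rw [Complex.arg_conj, if_neg harg]
    intro h
    exact (Complex.neg_pi_lt_arg ζ).ne (by linarith)
  rw [Complex.cpow_def_of_ne_zero (mul_ne_zero (by exact_mod_cast hr.ne') (inv_ne_zero hc0)),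
    Complex.cpow_def_of_ne_zero hζ0, Complex.log_ofReal_mul hr (inv_ne_zero hc0),
    Complex.log_inv _ harg', Complex.log_conj _ harg, Real.rpow_def_of_pos hr,
    Real.rpow_def_of_pos (norm_pos_iff.2 hζ0), ← Complex.log_re, Complex.real_smul, one_div, one_div,
    ← Complex.exp_neg, ← Complex.exp_neg]
  push_cast
  rw [← Complex.exp_add, ← Complex.exp_add]
  congr 1
  have h2 : (2 : ℂ) * (Complex.log ζ).re = Complex.log ζ + conj (Complex.log ζ) := by
    rw [Complex.add_conj]; push_cast; ring
  linear_combination (-(2 + (α : ℂ))) * h2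

lemma integrable_mul_kernel {α : ℝ} (hα : -1 < α) {f : Disc → ℂ} (hi : Integrable f (dA α))
    (w : Disc) : Integrable (fun z => f z * kernel α z w) (dA α) := by
  exact hi.mul_bdd (c := (rho w / 2) ^ (-(2 + α))) (continuous_kernel_left α w).aestronglyMeasurable
    (ae_of_all _ fun z => norm_kernel_le hα z w)

/-- The reproducing formula. -/
lemma IsAnalytic.integral_mul_kernel {α : ℝ} (hα : -1 < α) {f : Disc → ℂ} (hf : IsAnalytic f)
    (hi : Integrable f (dA α)) (w : Disc) : ∫ z, f z * kernel α z w ∂(dA α) = f w := by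
  have hkc := continuous_kernel_left α w
  have hc : Continuous fun z => f z * kernel α z w := hf.continuous.mul hkc
  have hi' := integrable_mul_kernel hα hi w
  have hk : ∀ u, (rho w ^ (2 + α) * kdist w u ^ (-(2 * (2 + α)))) •
      (f (moebius w u) * kernel α (moebius w u) w) = f (moebius w u) * kernel α w u := by
    intro u
    rw [← mul_smul_comm, kernel_moebius]
  have ha : IsAnalytic fun u => f (moebius w u) * kernel α w u :=
    (hf.comp_moebius w).mul (isAnalytic_kernel α w)
  have hai : Integrable (fun u => f (moebius w u) * kernel α w u) (dA α) := by
    refine ⟨ha.continuous.aestronglyMeasurable, ?_⟩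
    have h1 : ∫⁻ u, ‖f (moebius w u) * kernel α w u‖ₑ ∂(dA α)
        = ∫⁻ z, ‖f z * kernel α z w‖ₑ ∂(dA α) := by
      conv_rhs => rw [← lintegral_moebius w]
      refine lintegral_congr fun u => ?_
      have h1 := rho_pos w
      have h2 := kdist_pos w u
      rw [← hk, enorm_smul, Real.enorm_of_nonneg (by positivity)]
    rw [HasFiniteIntegral, h1]
    exact hi'.2
  rw [← integral_moebius w hc]
  simp_rw [hk]
  rw [ha.integral_eq hα hai]
  -- The mean value property gives the value at `0`, where `φ_w(0) = w` and `K_w(0) = 1`.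
  have : moebius w ⟨0, by simp⟩ = w := Subtype.ext (by simp [moebius])
  simp [this, kernel]

/-- The reproducing formula with `|K_z(w)|` bounded uniformly in `z`. If `f` is not integrable, the
right side is infinite. -/
lemma IsAnalytic.enorm_le {α : ℝ} (hα : -1 < α) {f : Disc → ℂ} (hf : IsAnalytic f) (w : Disc) :
    ‖f w‖ₑ ≤ ENNReal.ofReal ((rho w / 2) ^ (-(2 + α))) * ∫⁻ z, ‖f z‖ₑ ∂(dA α) := by
  have hr := rho_pos w
  by_cases hi : Integrable f (dA α)
  · rw [← hf.integral_mul_kernel hα hi w, ← lintegral_const_mul' _ _ ENNReal.ofReal_ne_top]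
    refine (enorm_integral_le_lintegral_enorm _).trans (lintegral_mono fun z => ?_)
    rw [enorm_mul, mul_comm]
    gcongr
    rw [← ofReal_norm]
    exact ENNReal.ofReal_le_ofReal (norm_kernel_le hα z w)
  · have : ∫⁻ z, ‖f z‖ₑ ∂(dA α) = ∞ := by
      by_contra h
      exact hi ⟨hf.continuous.aestronglyMeasurable, lt_top_iff_ne_top.2 h⟩
    rw [this, ENNReal.mul_top]
    · exact le_top
    · exact (ENNReal.ofReal_pos.2 (by positivity)).ne'

/-- The Bergman projection of an integrable function is analytic. -/
lemma isAnalytic_integral_mul_kernel {α : ℝ} (hα : -1 < α) {g : Disc → ℂ}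
    (hg : Integrable g (dA α)) : IsAnalytic fun w => ∫ u, g u * kernel α u w ∂(dA α) := by
  set a : ℂ := ((2 + α : ℝ) : ℂ) with ha
  refine ⟨fun x => ∫ u : Disc, g u * (1 - conj (u : ℂ) * x) ^ (-a) ∂(dA α), fun x hx => ?_,
    fun w => ?_⟩
  · have hx1 : ‖x‖ < 1 := mem_ball_zero_iff.1 hx
    -- On the ball of radius `R < 1` the kernel and its derivative are bounded uniformly in `u`,
    -- which permits differentiation under the integral.
    obtain ⟨R, hxR, hR⟩ := exists_between hx1
    have hR0 : 0 < 1 - R := by linarith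
    have hslit : ∀ (u : Disc), ∀ y ∈ Metric.ball (0 : ℂ) R, 1 - conj (u : ℂ) * y ∈
        Complex.slitPlane := fun u y hy => one_sub_mem_slitPlane u
          ⟨y, Metric.ball_subset_ball hR.le hy⟩
    have hlow : ∀ (u : Disc), ∀ y ∈ Metric.ball (0 : ℂ) R, 1 - R ≤ ‖1 - conj (u : ℂ) * y‖ := by
      intro u y hy
      have h1 := one_sub_norm_le_kdist ⟨y, Metric.ball_subset_ball hR.le hy⟩ u
      rw [kdist_comm, kdist] at h1
      rw [mem_ball_zero_iff] at hy
      exact le_trans (by linarith) h1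
    have hconj : Continuous fun u : Disc => conj (u : ℂ) :=
      Complex.continuous_conj.comp continuous_subtype_val
    have hcont : ∀ y ∈ Metric.ball (0 : ℂ) R, ∀ b : ℂ,
        Continuous fun u : Disc => (1 - conj (u : ℂ) * y) ^ b := fun y hy b =>
      Continuous.cpow (by fun_prop) continuous_const fun u => hslit u y hy
    have hbd : ∀ (u : Disc), ∀ y ∈ Metric.ball (0 : ℂ) R, ∀ b : ℝ, b ≤ 0 →
        ‖(1 - conj (u : ℂ) * y) ^ (b : ℂ)‖ ≤ (1 - R) ^ b := fun u y hy b hb => by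
      rw [Complex.norm_cpow_real]
      exact Real.rpow_le_rpow_of_nonpos hR0 (hlow u y hy) hb
    have hxm : x ∈ Metric.ball (0 : ℂ) R := mem_ball_zero_iff.2 hxR
    have hnhds : Metric.ball (0 : ℂ) R ∈ 𝓝 x := Metric.isOpen_ball.mem_nhds hxm
    have ha1 : -a = ((-(2 + α) : ℝ) : ℂ) := by rw [ha]; push_cast; ring
    have ha2 : -a - 1 = ((-(2 + α) - 1 : ℝ) : ℂ) := by rw [ha]; push_cast; ring
    have key := hasDerivAt_integral_of_dominated_loc_of_deriv_le (μ := dA α)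
      (F := fun x u => g u * (1 - conj (u : ℂ) * x) ^ (-a))
      (F' := fun x u => g u * (-a * (1 - conj (u : ℂ) * x) ^ (-a - 1) * -(conj (u : ℂ))))
      (bound := fun u => ‖g u‖ * (‖a‖ * (1 - R) ^ (-(2 + α) - 1))) (x₀ := x) hnhds
      (by
        filter_upwards [hnhds] with y hy
        exact hg.1.mul (hcont y hy _).aestronglyMeasurable)
      (by
        refine hg.mul_bdd (c := (1 - R) ^ (-(2 + α))) (hcont x hxm _).aestronglyMeasurable
          (ae_of_all _ fun u => ?_)
        rw [ha1]
        exact hbd u x hxm _ (by linarith))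
      (by
        refine hg.1.mul (Continuous.aestronglyMeasurable ?_)
        exact (continuous_const.mul (hcont x hxm _)).mul hconj.neg)
      (ae_of_all _ fun u y hy => by
        rw [norm_mul, norm_mul, norm_mul, norm_neg, norm_neg, Complex.norm_conj, mul_assoc]
        gcongr
        rw [ha2]
        have h1 := hbd u y hy (-(2 + α) - 1) (by linarith)
        have h2 := norm_lt_one u
        have h3 : (0 : ℝ) ≤ (1 - R) ^ (-(2 + α) - 1) := by positivity
        nlinarith [norm_nonneg (u : ℂ), norm_nonneg ((1 - conj (u : ℂ) * y) ^
          ((-(2 + α) - 1 : ℝ) : ℂ))])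
      (hg.norm.mul_const _)
      (ae_of_all _ fun u y hy => by
        have h1 : HasDerivAt (fun x : ℂ => 1 - conj (u : ℂ) * x) (-(conj (u : ℂ))) y := by
          simpa using ((hasDerivAt_id y).const_mul (conj (u : ℂ))).const_sub 1
        exact (h1.cpow_const (hslit u y hy)).const_mul (g u))
    exact key.2.differentiableAt.differentiableWithinAt
  · refine integral_congr_ae (ae_of_all _ fun u => ?_)
    simp only
    rw [kernel, Complex.cpow_neg, one_div]

/-! ### Compactness in `L^q` and continuity of the reproducing kernels. -/

/-- Montel's theorem for sequences on the unit disk. -/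
lemma exists_subseq_tendsto_of_forall_norm_le {F : ℕ → ℂ → ℂ}
    (hF : ∀ n, DifferentiableOn ℂ (F n) (Metric.ball 0 1))
    (hb : ∀ R < 1, ∃ M : ℝ, ∀ n x, ‖x‖ ≤ R → ‖F n x‖ ≤ M) :
    ∃ φ : ℕ → ℕ, StrictMono φ ∧ ∃ G : ℂ → ℂ, DifferentiableOn ℂ G (Metric.ball 0 1) ∧
      ∀ x ∈ Metric.ball (0 : ℂ) 1, Tendsto (fun n => F (φ n) x) atTop (𝓝 (G x)) := by
  set a : ℕ → ℕ → ℂ := fun n k => ((k.factorial : ℂ))⁻¹ * iteratedDeriv k (F n) 0 with ha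
  have hsum : ∀ n, ∀ x ∈ Metric.ball (0 : ℂ) 1, F n x = ∑' k, a n k * x ^ k := fun n x hx => by
    have h := Complex.taylorSeries_eq_on_ball' hx (hF n)
    simpa using h.symm
  have hcoef : ∀ R, 0 < R → R < 1 → ∃ M : ℝ, ∀ n k, ‖a n k‖ ≤ M / R ^ k := by
    intro R hR0 hR1
    obtain ⟨M, hM⟩ := hb R hR1
    refine ⟨M, fun n k => ?_⟩
    have hd : DiffContOnCl ℂ (F n) (Metric.ball 0 R) := by
      refine DifferentiableOn.diffContOnCl ((hF n).mono ?_)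
      rw [closure_ball _ hR0.ne']
      exact Metric.closedBall_subset_ball hR1
    have h := Complex.norm_iteratedDeriv_le_of_forall_mem_sphere_norm_le k hR0 hd
      (fun z hz => hM n z (mem_sphere_zero_iff_norm.1 hz).le)
    have hk : (0 : ℝ) < k.factorial := by exact_mod_cast k.factorial_pos
    rw [ha]
    simp only
    rw [norm_mul, norm_inv, Complex.norm_natCast, inv_mul_le_iff₀ hk, ← mul_div_assoc]
    exact h
  -- Any one radius confines the coefficient sequences to a compact product of balls, which yields
  -- the subsequence; the Cauchy estimates for radii near `1` later dominate the Taylor series.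
  obtain ⟨M0, hM0⟩ := hcoef (1 / 2) (by norm_num) (by norm_num)
  obtain ⟨b, -, φ, hφ, hlim⟩ := IsCompact.tendsto_subseq (x := a)
    (isCompact_univ_pi fun k => isCompact_closedBall (0 : ℂ) (M0 / (1 / 2) ^ k))
    (fun n k _ => mem_closedBall_zero_iff.2 (hM0 n k))
  have hlim' : ∀ k, Tendsto (fun n => a (φ n) k) atTop (𝓝 (b k)) := tendsto_pi_nhds.1 hlim
  have hbcoef : ∀ R, 0 < R → R < 1 → ∃ M : ℝ, (∀ n k, ‖a n k‖ ≤ M / R ^ k) ∧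
      ∀ k, ‖b k‖ ≤ M / R ^ k := by
    intro R hR0 hR1
    obtain ⟨M, hM⟩ := hcoef R hR0 hR1
    exact ⟨M, hM, fun k => le_of_tendsto (hlim' k).norm (Eventually.of_forall fun n => hM _ k)⟩
  have hterm : ∀ (M R r : ℝ) (c : ℂ) (x : ℂ) (k : ℕ), 0 < R → ‖x‖ ≤ r → ‖c‖ ≤ M / R ^ k →
      ‖c * x ^ k‖ ≤ M * (r / R) ^ k := by
    intro M R r c x k hR hx hc
    rw [norm_mul, norm_pow, div_pow, ← mul_div_assoc, mul_div_right_comm]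
    exact mul_le_mul hc (pow_le_pow_left₀ (norm_nonneg x) hx k) (by positivity)
      ((norm_nonneg c).trans hc)
  have hRr : ∀ x ∈ Metric.ball (0 : ℂ) 1, ∃ r R, ‖x‖ < r ∧ r < R ∧ R < 1 := by
    intro x hx
    obtain ⟨r, h1, h2⟩ := exists_between (mem_ball_zero_iff.1 hx)
    obtain ⟨R, h3, h4⟩ := exists_between h2
    exact ⟨r, R, h1, h3, h4⟩
  refine ⟨φ, hφ, fun x => ∑' k, b k * x ^ k, fun x hx => ?_, fun x hx => ?_⟩
  all_goals
    obtain ⟨r, R, h1, h2, h3⟩ := hRr x hx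
    have hr0 : 0 < r := (norm_nonneg x).trans_lt h1
    have hR0 : 0 < R := hr0.trans h2
    obtain ⟨M, hMa, hMb⟩ := hbcoef R hR0 h3
    have hs : Summable fun k : ℕ => M * (r / R) ^ k :=
      (summable_geometric_of_lt_one (by positivity) ((div_lt_one hR0).2 h2)).mul_left M
  · have hd : DifferentiableOn ℂ (fun x : ℂ => ∑' k, b k * x ^ k) (Metric.ball 0 r) :=
      Complex.differentiableOn_tsum_of_summable_norm hs (fun k => by fun_prop)
        Metric.isOpen_ball fun k y hy =>
          hterm M R r _ y k hR0 (mem_ball_zero_iff.1 hy).le (hMb k)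
    exact (hd.differentiableAt (Metric.isOpen_ball.mem_nhds
      (mem_ball_zero_iff.2 h1))).differentiableWithinAt
  · have ht := tendsto_tsum_of_dominated_convergence (f := fun n k => a (φ n) k * x ^ k)
      (g := fun k => b k * x ^ k) hs (fun k => (hlim' k).mul_const _)
      (Eventually.of_forall fun n k => hterm M R r _ x k hR0 h1.le (hMa _ k))
    refine ht.congr fun n => ?_
    rw [hsum _ x hx]

/-- Pointwise convergence with bounded `L^m` norms gives convergence in `L^q` for `q < m`. -/
lemma tendsto_eLpNorm_sub_of_eLpNorm_le {X : Type*} [MeasurableSpace X] {μ : Measure X}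
    [IsFiniteMeasure μ] {q m : ℝ} (hq : 1 ≤ q) (hqm : q < m) {g : ℕ → X → ℂ} {h : X → ℂ}
    {M : ℝ≥0∞} (hM : M ≠ ∞) (hg : ∀ n, AEStronglyMeasurable (g n) μ)
    (hgM : ∀ n, eLpNorm (g n) (ENNReal.ofReal m) μ ≤ M)
    (hlim : ∀ x, Tendsto (fun n => g n x) atTop (𝓝 (h x))) :
    MemLp h (ENNReal.ofReal m) μ ∧
      Tendsto (fun n => eLpNorm (g n - h) (ENNReal.ofReal q) μ) atTop (𝓝 0) := by
  have hm0 : 0 < m := by linarith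
  have hq0 : 0 < q := by linarith
  have hhm : AEStronglyMeasurable h μ := aestronglyMeasurable_of_tendsto_ae atTop hg (ae_of_all _ hlim)
  have hh : MemLp h (ENNReal.ofReal m) μ := by
    refine ⟨hhm, ?_⟩
    refine (Lp.eLpNorm_lim_le_liminf_eLpNorm hg h (ae_of_all _ hlim)).trans_lt ?_
    refine lt_of_le_of_lt ?_ hM.lt_top
    refine (liminf_le_liminf (Eventually.of_forall hgM)).trans_eq ?_
    exact liminf_const M
  have hle : ENNReal.ofReal q ≤ ENNReal.ofReal m := ENNReal.ofReal_le_ofReal hqm.le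
  refine ⟨hh, tendsto_Lp_finite_of_tendsto_ae (by simpa using hq) ENNReal.ofReal_ne_top hg
    (hh.mono_exponent hle) ?_ (ae_of_all _ hlim)⟩
  -- Uniform integrability: by Hölder's inequality the `L^q` norm over `s` is at most `M μ(s)^(1/q -
  -- 1/m)`. Vitali's theorem does the rest, Fatou's lemma having placed `h` in `L^m`.
  intro ε hε
  have hκ : 0 < 1 / q - 1 / m := by
    rw [sub_pos]; exact one_div_lt_one_div_of_lt hq0 hqm
  set κ := 1 / q - 1 / m with hκd
  set M' := M.toReal + 1 with hM'
  have hM'0 : 0 < M' := by positivity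
  have hMM' : M ≤ ENNReal.ofReal M' := by
    rw [← ENNReal.ofReal_toReal hM]
    exact ENNReal.ofReal_le_ofReal (by linarith)
  refine ⟨(ε / M') ^ (1 / κ), by positivity, fun n s hs hμs => ?_⟩
  rw [eLpNorm_indicator_eq_eLpNorm_restrict hs]
  have h1 := eLpNorm_le_eLpNorm_mul_rpow_measure_univ (μ := μ.restrict s) hle (hg n).restrict
  rw [Measure.restrict_apply_univ, ENNReal.toReal_ofReal hq0.le, ENNReal.toReal_ofReal hm0.le,
    ← hκd] at h1
  calc _ ≤ _ := h1
    _ ≤ ENNReal.ofReal M' * ENNReal.ofReal ((ε / M') ^ (1 / κ)) ^ κ := by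
        gcongr
        exact ((eLpNorm_mono_measure _ Measure.restrict_le_self).trans (hgM n)).trans hMM'
    _ = ENNReal.ofReal ε := by
        rw [ENNReal.ofReal_rpow_of_pos (by positivity), ← Real.rpow_mul (by positivity),
          one_div_mul_cancel hκ.ne', Real.rpow_one, ← ENNReal.ofReal_mul hM'0.le]
        congr 1
        field_simp

/-- While `z` stays away from the circle, `kdist z w` lies between `ε / 2` and `2`, so the weight in
`KernelBound` is bounded below. The minimum in `ℓ` covers both signs of the exponent. -/
lemma KernelBound.exists_lintegral_le {α m : ℝ} (hα : -1 < α) {C : ℝ≥0∞} (hC : C ≠ ∞) (hm : 0 < m)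
    {H : Disc → Disc → ℝ≥0∞} (h : KernelBound α m C H) {ε : ℝ} (hε : 0 < ε) :
    ∃ M : ℝ≥0∞, M ≠ ∞ ∧ ∀ z, ε ≤ rho z → ∫⁻ w, H z w ^ m ∂(dA α) ≤ M := by
  set s := -((2 + α) * (2 - m)) with hs
  set ℓ := ε ^ (2 + α) * min ((ε / 2) ^ s) (2 ^ s) with hℓ
  have hℓ0 : 0 < ℓ := mul_pos (by positivity) (lt_min (by positivity) (by positivity))
  refine ⟨C ^ m / ENNReal.ofReal ℓ, ?_, fun z hz => ?_⟩
  · exact ENNReal.div_ne_top (ENNReal.rpow_ne_top_of_nonneg hm.le hC)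
      (ENNReal.ofReal_pos.2 hℓ0).ne'
  · rw [ENNReal.le_div_iff_mul_le (Or.inl (ENNReal.ofReal_pos.2 hℓ0).ne')
      (Or.inl ENNReal.ofReal_ne_top), ← lintegral_mul_const' _ _ ENNReal.ofReal_ne_top]
    refine le_trans (lintegral_mono fun w => ?_) (h z)
    have h1 := rho_pos z
    have h2 := kdist_pos z w
    have h3 := half_rho_le_kdist z w
    have h4 := kdist_le_two z w
    gcongr
    rw [hℓ]
    refine mul_le_mul (Real.rpow_le_rpow hε.le hz (by linarith)) ?_ (by positivity) (by positivity)
    · rcases le_or_gt 0 s with h0 | h0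
      · exact (min_le_left _ _).trans (Real.rpow_le_rpow (by positivity) (by linarith) h0)
      · exact (min_le_right _ _).trans (Real.rpow_le_rpow_of_nonpos h2 h4 h0.le)

lemma isAnalytic_of_mem {p α : ℝ} {f : Disc → ℂ} (hf : f ∈ bergmanSpace p α) : IsAnalytic f := hf.1

lemma memLp_of_mem {p α : ℝ} {f : Disc → ℂ} (hf : f ∈ bergmanSpace p α) :
    MemLp f (ENNReal.ofReal p) (dA α) := hf.2

/-- Local boundedness of functions in terms of their `L^q` norms. -/
lemma IsAnalytic.enorm_le_eLpNorm {α q : ℝ} (hα : -1 < α) (hq : 1 ≤ q) {f : Disc → ℂ}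
    (hf : IsAnalytic f) (w : Disc) :
    ‖f w‖ₑ ≤ ENNReal.ofReal ((rho w / 2) ^ (-(2 + α))) * eLpNorm f (ENNReal.ofReal q) (dA α) := by
  have := isProbabilityMeasure_dA hα
  refine (hf.enorm_le hα w).trans ?_
  gcongr
  rw [← eLpNorm_one_eq_lintegral_enorm]
  exact eLpNorm_le_eLpNorm_of_exponent_le (by simpa using hq) hf.continuous.aestronglyMeasurable

/-- A sequence of analytic functions bounded in `L^m` has a subsequence that converges pointwise and
in `L^q`, for `q < m`. -/
lemma exists_subseq_tendsto_eLpNorm {α q m : ℝ} (hα : -1 < α) (hq : 1 ≤ q) (hqm : q < m)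
    {g : ℕ → Disc → ℂ} (hg : ∀ n, IsAnalytic (g n)) {M : ℝ≥0∞} (hM : M ≠ ∞)
    (hgM : ∀ n, eLpNorm (g n) (ENNReal.ofReal m) (dA α) ≤ M) :
    ∃ φ : ℕ → ℕ, StrictMono φ ∧ ∃ h : Disc → ℂ, IsAnalytic h ∧
      MemLp h (ENNReal.ofReal m) (dA α) ∧
      Tendsto (fun n => eLpNorm (g (φ n) - h) (ENNReal.ofReal q) (dA α)) atTop (𝓝 0) := by
  have := isProbabilityMeasure_dA hα
  have hga := hg
  choose F hF hgF using hg
  obtain ⟨φ, hφ, G, hG, hlim⟩ := exists_subseq_tendsto_of_forall_norm_le hF (by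
    intro R hR
    -- `R` may be negative, hence `max R 0`.
    refine ⟨((1 - max R 0 ^ 2) / 2) ^ (-(2 + α)) * M.toReal, fun n x hx => ?_⟩
    have hx1 : x ∈ Metric.ball (0 : ℂ) 1 := mem_ball_zero_iff.2 (hx.trans_lt hR)
    have h := (hga n).enorm_le_eLpNorm hα
      (hq.trans hqm.le) ⟨x, hx1⟩
    rw [hgF] at h
    have h2 := h.trans (mul_le_mul_right (hgM n) _)
    have hr := rho_pos ⟨x, hx1⟩
    have h3 := ENNReal.toReal_mono (ENNReal.mul_ne_top ENNReal.ofReal_ne_top hM) h2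
    rw [toReal_enorm, ENNReal.toReal_mul, ENNReal.toReal_ofReal (by positivity)] at h3
    refine h3.trans ?_
    have hR1 : max R 0 < 1 := max_lt hR one_pos
    have hpos : 0 < 1 - max R 0 ^ 2 := by nlinarith [le_max_right R 0]
    refine mul_le_mul_of_nonneg_right ?_ ENNReal.toReal_nonneg
    refine Real.rpow_le_rpow_of_nonpos (by positivity) ?_ (by linarith)
    have : ‖x‖ ^ 2 ≤ max R 0 ^ 2 :=
      pow_le_pow_left₀ (norm_nonneg x) (hx.trans (le_max_left _ _)) 2
    rw [rho]
    linarith)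
  have h := tendsto_eLpNorm_sub_of_eLpNorm_le (μ := dA α) hq hqm (g := fun n => g (φ n))
    (h := fun w => G w) hM
    (fun n => (hga (φ n)).continuous.aestronglyMeasurable)
    (fun n => hgM _) (fun w => by simp_rw [hgF]; exact hlim w w.2)
  exact ⟨φ, hφ, fun w => G w, ⟨G, hG, fun _ => rfl⟩, h⟩

lemma tendsto_eLpNorm_kernel {α p : ℝ} (hα : -1 < α) (hp : 1 ≤ p) (z₀ : Disc) :
    Tendsto (fun z => eLpNorm (kernel α z - kernel α z₀) (ENNReal.ofReal p) (dA α)) (𝓝 z₀)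
      (𝓝 0) := by
  have := isProbabilityMeasure_dA hα
  rw [tendsto_iff_seq_tendsto]
  intro z hz
  have hev : ∀ᶠ n in atTop, rho z₀ / 2 < rho (z n) :=
    ((continuous_rho.tendsto z₀).comp hz).eventually (lt_mem_nhds (half_lt_self (rho_pos z₀)))
  obtain ⟨N, hN⟩ := eventually_atTop.1 hev
  rw [← tendsto_add_atTop_iff_nat N]
  set M : ℝ := (rho z₀ / 2 / 2) ^ (-(2 + α)) with hM
  have hbd : ∀ n w, ‖kernel α (z (n + N)) w‖ ≤ M := by
    intro n w
    have h0 := rho_pos z₀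
    rw [norm_kernel]
    refine Real.rpow_le_rpow_of_nonpos (by positivity) ?_ (by linarith)
    refine le_trans ?_ (half_rho_le_kdist (z (n + N)) w)
    have := hN (n + N) (Nat.le_add_left _ _)
    linarith
  -- The kernels near `z₀` are uniformly bounded, so any exponent above `p` would serve in place of
  -- `p + 1`.
  refine (tendsto_eLpNorm_sub_of_eLpNorm_le (μ := dA α) hp (lt_add_one p)
    (g := fun n => kernel α (z (n + N))) (h := kernel α z₀) (M := ENNReal.ofReal M)
    ENNReal.ofReal_ne_top (fun n => (isAnalytic_kernel α _).continuous.aestronglyMeasurable)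
    (fun n => ?_) fun w => ?_).2
  · refine (eLpNorm_le_of_ae_bound (ae_of_all _ (hbd n))).trans_eq ?_
    simp
  · exact ((continuous_kernel_left α w).tendsto z₀).comp ((tendsto_add_atTop_iff_nat N).2 hz)

/-! ### The functions `S K_z`: translation of the hypothesis and continuity in `z`. -/

namespace Operator

variable {p q α : ℝ}

/-- The functions `S K_z`. -/
def kern (S : Operator p q α) (z : Disc) : Disc → ℂ := S.toFun ⟨kernel α z, S.kernel_mem z⟩

lemma kern_mem (S : Operator p q α) (z : Disc) : S.kern z ∈ bergmanSpace q α := Subtype.property _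

lemma isAnalytic_kern (S : Operator p q α) (z : Disc) : IsAnalytic (S.kern z) :=
  isAnalytic_of_mem (S.kern_mem z)

lemma conjOne_apply (S : Operator p q α) (z w : Disc) :
    S.conjOne z w = S.kern z (moebius z w) *
      (((rho z ^ ((2 + α) / 2) : ℝ) : ℂ) * normKernel α z w) := by
  have h : (⟨U α z 1, S.U_one_mem z⟩ : S.domain)
      = ((rho z ^ ((2 + α) / 2) : ℝ) : ℂ) • ⟨kernel α z, S.kernel_mem z⟩ := by
    apply Subtype.ext
    funext w
    simp [U, normKernel, rho]
  rw [conjOne, conjU, h, map_smul, U, kern, Submodule.coe_smul, Pi.smul_apply, smul_eq_mul]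
  ring

/-- Substitution by the involution `φ_z`; this is where the weight in `KernelBound` comes from. -/
lemma lintegral_conjOne (S : Operator p q α) (z : Disc) {m : ℝ} (hm : 0 ≤ m) :
    ∫⁻ w, ‖S.conjOne z w‖ₑ ^ m ∂(dA α) = ∫⁻ w, ‖S.kern z w‖ₑ ^ m *
      ENNReal.ofReal (rho z ^ (2 + α) * kdist z w ^ (-((2 + α) * (2 - m)))) ∂(dA α) := by
  conv_rhs => rw [← lintegral_moebius z]
  refine lintegral_congr fun w => ?_
  have h1 := rho_pos z
  have h2 := kdist_pos z w
  rw [conjOne_apply, enorm_mul, ENNReal.mul_rpow_of_nonneg _ _ hm, mul_left_comm]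
  congr 1
  rw [← ofReal_norm, norm_mul, norm_normKernel, Complex.norm_real,
    Real.norm_of_nonneg (by positivity), ENNReal.ofReal_rpow_of_pos (by positivity),
    ← ENNReal.ofReal_mul (by positivity), kdist_moebius]
  congr 1
  generalize rho z = r at h1
  generalize kdist z w = k at h2
  obtain ⟨r, rfl⟩ : ∃ u, r = Real.exp u := ⟨Real.log r, (Real.exp_log h1).symm⟩
  obtain ⟨k, rfl⟩ : ∃ u, k = Real.exp u := ⟨Real.log k, (Real.exp_log h2).symm⟩
  simp only [← Real.exp_mul, ← Real.exp_add, ← Real.exp_sub]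
  congr 1
  ring

lemma kernelBound (S : Operator p q α) {m : ℝ} (hm : 0 < m) {C : ℝ≥0∞}
    (h : ∀ z, bnorm m α (S.conjOne z) ≤ C) : KernelBound α m C fun z w => ‖S.kern z w‖ₑ := by
  intro z
  have h1 := h z
  rw [bnorm, eLpNorm_eq_lintegral_rpow_enorm_toReal (ENNReal.ofReal_pos.2 hm).ne'
    ENNReal.ofReal_ne_top, ENNReal.toReal_ofReal hm.le, one_div,
    ENNReal.rpow_inv_le_iff hm] at h1
  rw [← lintegral_conjOne S z hm.le]
  exact h1

/-- As `z → z₀`, the functions `S K_z` are bounded in `L^m`, so every sequence of them has a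
subsequence converging in `L^r` to some `g`. Since `K_z → K_{z₀}` in `L^p`, closability forces `g =
S K_{z₀}`. -/
lemma tendsto_eLpNorm_kern (S : Operator p q α) (hα : -1 < α) (hp : 1 ≤ p) (hS : S.IsClosable)
    {m r : ℝ} {C : ℝ≥0∞} (hC : C ≠ ∞) (h : KernelBound α m C fun z w => ‖S.kern z w‖ₑ)
    (hr : 1 ≤ r) (hrm : r < m) (hqr : q ≤ r) (z₀ : Disc) :
    Tendsto (fun z => eLpNorm (S.kern z - S.kern z₀) (ENNReal.ofReal r) (dA α)) (𝓝 z₀) (𝓝 0) := by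
  have := isProbabilityMeasure_dA hα
  have hm0 : 0 < m := by linarith
  rw [tendsto_iff_seq_tendsto]
  intro z hz
  have hev : ∀ᶠ n in atTop, rho z₀ / 2 < rho (z n) :=
    ((continuous_rho.tendsto z₀).comp hz).eventually (lt_mem_nhds (half_lt_self (rho_pos z₀)))
  obtain ⟨N, hN⟩ := eventually_atTop.1 hev
  rw [← tendsto_add_atTop_iff_nat N]
  obtain ⟨M, hM, hMle⟩ := h.exists_lintegral_le hα hC hm0 (half_pos (rho_pos z₀))
  have hz' := (tendsto_add_atTop_iff_nat N).2 hz
  refine tendsto_of_subseq_tendsto fun ns hns => ?_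
  obtain ⟨φ, hφ, g, hga, hgm, hlim⟩ := exists_subseq_tendsto_eLpNorm hα hr hrm
    (g := fun n => S.kern (z (ns n + N))) (fun n => S.isAnalytic_kern _) (M := M ^ (1 / m))
    (ENNReal.rpow_ne_top_of_nonneg (by positivity) hM) (fun n => by
      rw [eLpNorm_eq_lintegral_rpow_enorm_toReal (ENNReal.ofReal_pos.2 hm0).ne'
        ENNReal.ofReal_ne_top, ENNReal.toReal_ofReal hm0.le]
      gcongr
      exact hMle _ (hN _ (Nat.le_add_left _ _)).le)
  refine ⟨φ, ?_⟩
  have hgq : g ∈ bergmanSpace q α :=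
    ⟨hga, hgm.mono_exponent (ENNReal.ofReal_le_ofReal (hqr.trans hrm.le))⟩
  have hzz : Tendsto (fun n => z (ns (φ n) + N)) atTop (𝓝 z₀) :=
    hz'.comp (hns.comp hφ.tendsto_atTop)
  have hz0 := hS
    (fun n => ⟨kernel α (z (ns (φ n) + N)), S.kernel_mem _⟩ - ⟨kernel α z₀, S.kernel_mem _⟩)
    (⟨g, hgq⟩ - ⟨S.kern z₀, S.kern_mem z₀⟩)
    ((tendsto_eLpNorm_kernel hα hp z₀).comp hzz) (by
      have hle : ∀ n, bnorm q α ((S.toFun (⟨kernel α (z (ns (φ n) + N)), S.kernel_mem _⟩ -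
          ⟨kernel α z₀, S.kernel_mem _⟩) : Disc → ℂ) -
          (((⟨g, hgq⟩ : bergmanSpace q α) - ⟨S.kern z₀, S.kern_mem z₀⟩ : bergmanSpace q α) :
            Disc → ℂ)) ≤ eLpNorm (S.kern (z (ns (φ n) + N)) - g) (ENNReal.ofReal r) (dA α) := by
        intro n
        have : ((S.toFun (⟨kernel α (z (ns (φ n) + N)), S.kernel_mem _⟩ -
          ⟨kernel α z₀, S.kernel_mem _⟩) : Disc → ℂ) -
          (((⟨g, hgq⟩ : bergmanSpace q α) - ⟨S.kern z₀, S.kern_mem z₀⟩ : bergmanSpace q α) :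
            Disc → ℂ)) = S.kern (z (ns (φ n) + N)) - g := by
          rw [map_sub]
          funext w
          simp [kern]
        rw [bnorm, this]
        exact eLpNorm_le_eLpNorm_of_exponent_le (ENNReal.ofReal_le_ofReal hqr)
          ((S.isAnalytic_kern _).sub hga).continuous.aestronglyMeasurable
      exact tendsto_of_tendsto_of_tendsto_of_le_of_le tendsto_const_nhds hlim (fun _ => zero_le)
        hle)
  have hg : g = S.kern z₀ := congrArg Subtype.val (sub_eq_zero.1 hz0)
  rw [← hg]
  exact hlim

/-- Norms control point values locally uniformly in `w`, so norm continuity in `z` and continuity in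
`w` give joint continuity. -/
lemma continuous_kern (S : Operator p q α) (hα : -1 < α) {r : ℝ} (hr : 1 ≤ r)
    (h : ∀ z₀, Tendsto (fun z => eLpNorm (S.kern z - S.kern z₀) (ENNReal.ofReal r) (dA α)) (𝓝 z₀)
      (𝓝 0)) : Continuous fun x : Disc × Disc => S.kern x.1 x.2 := by
  rw [continuous_iff_continuousAt]
  rintro ⟨z₀, w₀⟩
  have h1 : Tendsto (fun x : Disc × Disc => S.kern x.1 x.2 - S.kern z₀ x.2) (𝓝 (z₀, w₀)) (𝓝 0) := by
    rw [tendsto_zero_iff_enorm_tendsto_zero]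
    have hb : Tendsto (fun x : Disc × Disc => ENNReal.ofReal ((rho x.2 / 2) ^ (-(2 + α))) *
        eLpNorm (S.kern x.1 - S.kern z₀) (ENNReal.ofReal r) (dA α)) (𝓝 (z₀, w₀))
        (𝓝 (ENNReal.ofReal ((rho w₀ / 2) ^ (-(2 + α))) * 0)) := by
      refine ENNReal.Tendsto.mul ?_ (Or.inr ENNReal.zero_ne_top) ?_
        (Or.inr ENNReal.ofReal_ne_top)
      · refine ENNReal.tendsto_ofReal ?_
        have hc : ContinuousAt (fun x : Disc × Disc => (rho x.2 / 2) ^ (-(2 + α))) (z₀, w₀) := by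
          have := continuous_rho
          refine ContinuousAt.rpow_const (by fun_prop) (Or.inl ?_)
          have := rho_pos w₀
          positivity
        exact hc
      · exact (h z₀).comp (continuous_fst.tendsto (z₀, w₀))
    rw [mul_zero] at hb
    refine tendsto_of_tendsto_of_tendsto_of_le_of_le tendsto_const_nhds hb (fun _ => zero_le)
      fun x => ?_
    exact ((S.isAnalytic_kern x.1).sub (S.isAnalytic_kern z₀)).enorm_le_eLpNorm hα hr x.2
  have h2 : Tendsto (fun x : Disc × Disc => S.kern z₀ x.2) (𝓝 (z₀, w₀)) (𝓝 (S.kern z₀ w₀)) :=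
    ((S.isAnalytic_kern z₀).continuous.comp continuous_snd).tendsto (z₀, w₀)
  have h3 := h1.add h2
  simp only [sub_add_cancel, zero_add] at h3
  exact h3

end Operator

/-! ### Bochner integrals in `L^P` and integral operators with absolutely bounded kernels. -/

lemma exists_norm_setIntegral_le {W : Type*} [MeasurableSpace W] {μ : Measure W} [IsFiniteMeasure μ]
    {P : ℝ≥0∞} [hP : Fact (1 ≤ P)] :
    ∃ c : ℝ, ∀ g : Lp ℂ P μ, Integrable g μ ∧ ∫ w, ‖g w‖ ∂μ ≤ c * ‖g‖ := by
  refine ⟨(μ Set.univ ^ (1 / (1 : ℝ≥0∞).toReal - 1 / P.toReal)).toReal, fun g => ?_⟩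
  have hi : Integrable g μ := (Lp.memLp g).integrable hP.out
  refine ⟨hi, ?_⟩
  have h1 := eLpNorm_le_eLpNorm_mul_rpow_measure_univ (μ := μ) hP.out (Lp.memLp g).1
  rw [eLpNorm_one_eq_lintegral_enorm] at h1
  rw [integral_norm_eq_lintegral_enorm hi.1, mul_comm, Lp.norm_def, ← ENNReal.toReal_mul]
  refine ENNReal.toReal_mono (ENNReal.mul_ne_top (Lp.eLpNorm_ne_top g) ?_) h1
  refine ENNReal.rpow_ne_top_of_nonneg ?_ (measure_ne_top _ _)
  rw [ENNReal.toReal_one, sub_nonneg, div_one]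
  rcases eq_or_ne P ∞ with rfl | hPt
  · simp
  · have : (1 : ℝ) ≤ P.toReal := by
      rw [← ENNReal.toReal_one]; exact ENNReal.toReal_mono hPt hP.out
    exact div_le_one_of_le₀ this (by linarith)

/-- A Bochner integral in `L^P` is given by the pointwise integral. -/
lemma coeFn_integral_Lp {Z W : Type*} [MeasurableSpace Z] [MeasurableSpace W] {ν : Measure Z}
    {μ : Measure W} [IsFiniteMeasure μ] [SFinite ν] {P : ℝ≥0∞} [hP : Fact (1 ≤ P)]
    {Φ : Z → Lp ℂ P μ} (hΦ : Integrable Φ ν) {G : Z → W → ℂ}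
    (hG : StronglyMeasurable (Function.uncurry G)) (h : ∀ z, Φ z =ᵐ[μ] G z) :
    ⇑(∫ z, Φ z ∂ν) =ᵐ[μ] fun w => ∫ z, G z w ∂ν := by
  obtain ⟨c, hc⟩ := exists_norm_setIntegral_le (μ := μ) (P := P)
  have hGi : Integrable (Function.uncurry G) (ν.prod μ) := by
    rw [integrable_prod_iff hG.aestronglyMeasurable]
    refine ⟨ae_of_all _ fun z => (integrable_congr (h z)).1 (hc (Φ z)).1, ?_⟩
    refine Integrable.mono' (hΦ.norm.const_mul c)
      hG.norm.integral_prod_right.aestronglyMeasurable (ae_of_all _ fun z => ?_)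
    rw [Real.norm_of_nonneg (integral_nonneg fun _ => norm_nonneg _)]
    refine le_trans (le_of_eq ?_) (hc (Φ z)).2
    refine integral_congr_ae ?_
    filter_upwards [h z] with w hw
    rw [hw]
    rfl
  -- Compare integrals over every measurable `s`: integration over `s` is a continuous functional on
  -- `L^P`, so it commutes with the Bochner integral, and Fubini's theorem handles the pointwise
  -- one.
  refine Integrable.ae_eq_of_forall_setIntegral_eq _ _ (hc _).1 hGi.integral_prod_right
    fun s hs _ => ?_
  have hlin : ∃ L : Lp ℂ P μ →L[ℂ] ℂ, ∀ g, L g = ∫ w in s, g w ∂μ := by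
    refine ⟨LinearMap.mkContinuous
      { toFun := fun g => ∫ w in s, g w ∂μ
        map_add' := fun g g' => ?_
        map_smul' := fun a g => ?_ } c fun g => ?_, fun g => rfl⟩
    · rw [← integral_add (hc g).1.integrableOn (hc g').1.integrableOn]
      refine integral_congr_ae (ae_restrict_of_ae ?_)
      filter_upwards [Lp.coeFn_add g g'] with w hw
      rw [hw]; rfl
    · rw [RingHom.id_apply, ← integral_smul]
      refine integral_congr_ae (ae_restrict_of_ae ?_)
      filter_upwards [Lp.coeFn_smul a g] with w hw
      rw [hw]; rfl
    · refine (norm_integral_le_integral_norm _).trans (le_trans ?_ (hc g).2)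
      exact setIntegral_le_integral (hc g).1.norm (ae_of_all _ fun _ => norm_nonneg _)
  obtain ⟨L, hL⟩ := hlin
  rw [← hL, ← L.integral_comp_comm hΦ]
  have hGs : Integrable (Function.uncurry G) (ν.prod (μ.restrict s)) := by
    refine hGi.mono_measure ?_
    have : (ν.prod (μ.restrict s)) = (ν.prod μ).restrict (Set.univ ×ˢ s) := by
      rw [← Measure.prod_restrict, Measure.restrict_univ]
    rw [this]
    exact Measure.restrict_le_self
  rw [← integral_integral_swap hGs]
  refine integral_congr_ae (ae_of_all _ fun z => ?_)
  simp only
  rw [hL]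
  exact integral_congr_ae (ae_restrict_of_ae (h z))

/-- The integral is a multiple of the average, and averages stay in closed convex sets. -/
lemma integral_mem_of_isClosed {Z E : Type*} [MeasurableSpace Z] {ν : Measure Z} [IsFiniteMeasure ν]
    [NormedAddCommGroup E] [NormedSpace ℂ E] [CompleteSpace E] (s : Submodule ℂ E)
    (hs : IsClosed (s : Set E)) {Φ : Z → E} (hΦ : Integrable Φ ν) (h : ∀ z, Φ z ∈ s) :
    ∫ z, Φ z ∂ν ∈ s := by
  rcases eq_or_ne ν 0 with rfl | hν
  · simp
  have : NeZero ν := ⟨hν⟩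
  have h1 := Convex.average_mem (s := (s : Set E)) ((s.restrictScalars ℝ).convex) hs
    (ae_of_all ν h) hΦ
  rw [← measure_smul_average]
  exact (s.restrictScalars ℝ).smul_mem _ h1

/-- An exhaustion of the disk by compact sets. -/
def exhaustion (n : ℕ) : Set Disc := {z | ‖(z : ℂ)‖ ≤ 1 - 1 / ((n : ℝ) + 1)}

lemma isCompact_exhaustion (n : ℕ) : IsCompact (exhaustion n) := by
  rw [Subtype.isCompact_iff]
  have : Subtype.val '' exhaustion n = Metric.closedBall (0 : ℂ) (1 - 1 / ((n : ℝ) + 1)) := by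
    ext x
    simp only [exhaustion, Set.mem_image, mem_closedBall_zero_iff]
    constructor
    · rintro ⟨z, hz, rfl⟩
      exact hz
    · intro hx
      have : (0 : ℝ) < 1 / ((n : ℝ) + 1) := by positivity
      exact ⟨⟨x, mem_ball_zero_iff.2 (by linarith)⟩, hx, rfl⟩
  rw [this]
  exact isCompact_closedBall _ _

lemma eventually_mem_exhaustion (z : Disc) : ∀ᶠ n in atTop, z ∈ exhaustion n := by
  have h : Tendsto (fun n : ℕ => 1 - 1 / ((n : ℝ) + 1)) atTop (𝓝 (1 - 0)) :=
    tendsto_one_div_add_atTop_nhds_zero_nat.const_sub 1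
  rw [sub_zero] at h
  filter_upwards [h.eventually (lt_mem_nhds (norm_lt_one z))] with n hn using hn.le

lemma measurableSet_exhaustion (n : ℕ) : MeasurableSet (exhaustion n) :=
  (isCompact_exhaustion n).measurableSet

/-- Boundedness from `L^p` to `L^r` of the integral operator with kernel `|k z w|`, with the
constant `A^(1/r)`. -/
def AbsBounded (α p r : ℝ) (A : ℝ≥0∞) (k : Disc → Disc → ℂ) : Prop :=
  ∀ f : Disc → ℝ≥0∞, Measurable f →
    ∫⁻ w, (∫⁻ z, f z * ‖k z w‖ₑ ∂(dA α)) ^ r ∂(dA α) ≤ A * (∫⁻ z, f z ^ p ∂(dA α)) ^ (r / p)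

lemma AbsBounded.rpow_le {α p r : ℝ} (hp : 0 < p) (hr : 0 < r) {A : ℝ≥0∞} {k : Disc → Disc → ℂ}
    (h : AbsBounded α p r A k) {f : Disc → ℝ≥0∞} (hf : Measurable f) :
    (∫⁻ w, (∫⁻ z, f z * ‖k z w‖ₑ ∂(dA α)) ^ r ∂(dA α)) ^ (1 / r)
      ≤ A ^ (1 / r) * (∫⁻ z, f z ^ p ∂(dA α)) ^ (1 / p) := by
  refine (ENNReal.rpow_le_rpow (h f hf) (by positivity)).trans_eq ?_
  rw [ENNReal.mul_rpow_of_nonneg _ _ (by positivity), ← ENNReal.rpow_mul]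
  congr 2
  field_simp

lemma eLpNorm_ofReal {X : Type*} [MeasurableSpace X] {μ : Measure X} {p : ℝ} (hp : 0 < p)
    (f : X → ℂ) : eLpNorm f (ENNReal.ofReal p) μ = (∫⁻ x, ‖f x‖ₑ ^ p ∂μ) ^ (1 / p) := by
  rw [eLpNorm_eq_lintegral_rpow_enorm_toReal (ENNReal.ofReal_pos.2 hp).ne' ENNReal.ofReal_ne_top,
    ENNReal.toReal_ofReal hp.le]

lemma lintegral_rpow_ne_top {X : Type*} [MeasurableSpace X] {μ : Measure X} {p : ℝ} (hp : 0 < p)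
    {f : X → ℂ} (hf : MemLp f (ENNReal.ofReal p) μ) : ∫⁻ x, ‖f x‖ₑ ^ p ∂μ ≠ ∞ := by
  have h := hf.2.ne
  rw [eLpNorm_ofReal hp] at h
  contrapose! h
  rw [h, ENNReal.top_rpow_of_pos (by positivity)]

/-- The error is the operator applied to the part of `f` outside the compact set, whose `L^p` norm
tends to zero by dominated convergence. -/
lemma AbsBounded.tendsto {α p r : ℝ} (hp : 0 < p) (hr : 0 < r) {A : ℝ≥0∞}
    (hA : A ≠ ∞) {k : Disc → Disc → ℂ} (h : AbsBounded α p r A k) {f : Disc → ℂ}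
    (hfc : Continuous f) (hf : MemLp f (ENNReal.ofReal p) (dA α))
    (hi : ∀ w, Integrable (fun z => f z * k z w) (dA α)) :
    Tendsto (fun n => eLpNorm (fun w => ∫ z in exhaustion n, f z * k z w ∂(dA α) -
      ∫ z, f z * k z w ∂(dA α)) (ENNReal.ofReal r) (dA α)) atTop (𝓝 0) := by
  set g : ℕ → Disc → ℝ≥0∞ := fun n => (exhaustion n)ᶜ.indicator fun z => ‖f z‖ₑ with hg
  have hgm : ∀ n, Measurable (g n) := fun n =>
    hfc.enorm.measurable.indicator (measurableSet_exhaustion n).compl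
  have hle : ∀ n, eLpNorm (fun w => ∫ z in exhaustion n, f z * k z w ∂(dA α) -
      ∫ z, f z * k z w ∂(dA α)) (ENNReal.ofReal r) (dA α)
      ≤ A ^ (1 / r) * (∫⁻ z, g n z ^ p ∂(dA α)) ^ (1 / p) := by
    intro n
    refine le_trans ?_ (h.rpow_le hp hr (hgm n))
    rw [eLpNorm_ofReal hr]
    gcongr with w
    rw [← integral_add_compl (measurableSet_exhaustion n) (hi w), sub_add_cancel_left, enorm_neg]
    refine (enorm_integral_le_lintegral_enorm _).trans_eq ?_
    rw [← lintegral_indicator (measurableSet_exhaustion n).compl]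
    refine lintegral_congr fun z => ?_
    by_cases hz : z ∈ (exhaustion n)ᶜ
    · simp only [hg, Set.indicator_of_mem hz, enorm_mul]
    · simp only [hg, Set.indicator_of_notMem hz, zero_mul]
  have hlim : Tendsto (fun n => ∫⁻ z, g n z ^ p ∂(dA α)) atTop (𝓝 0) := by
    have h1 := tendsto_lintegral_of_dominated_convergence (μ := dA α) (F := fun n z => g n z ^ p)
      (f := fun _ => 0) (fun z => ‖f z‖ₑ ^ p) (fun n => by have := hgm n; fun_prop)
      (fun n => ae_of_all _ fun z =>
        ENNReal.rpow_le_rpow (Set.indicator_le_self _ _ _) hp.le) (lintegral_rpow_ne_top hp hf)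
      (ae_of_all _ fun z => by
        refine tendsto_const_nhds.congr' ?_
        filter_upwards [eventually_mem_exhaustion z] with n hn
        rw [hg]
        simp only
        rw [Set.indicator_of_notMem (by simpa using hn), ENNReal.zero_rpow_of_pos hp])
    simpa using h1
  have hlim2 : Tendsto (fun n => A ^ (1 / r) * (∫⁻ z, g n z ^ p ∂(dA α)) ^ (1 / p)) atTop
      (𝓝 (A ^ (1 / r) * 0 ^ (1 / p))) :=
    ENNReal.Tendsto.const_mul (hlim.ennrpow_const _)
      (Or.inr (ENNReal.rpow_ne_top_of_nonneg (by positivity) hA))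
  rw [ENNReal.zero_rpow_of_pos (by positivity), mul_zero] at hlim2
  exact tendsto_of_tendsto_of_tendsto_of_le_of_le tendsto_const_nhds hlim2 (fun _ => zero_le) hle

lemma exists_absBounded_kernel {α p : ℝ} (hα : -1 < α) (hp : 1 < p) :
    ∃ A : ℝ≥0∞, A ≠ ∞ ∧ AbsBounded α p p A (kernel α) := by
  obtain ⟨K, hK, h⟩ := exists_lintegral_bergman_le hp hα
  refine ⟨K, hK, fun f hf => ?_⟩
  rw [div_self (by linarith), ENNReal.rpow_one]
  simp_rw [enorm_kernel]
  exact h f hf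

/-- The product `f z * k z w` is integrable on the square of the disk. -/
lemma AbsBounded.integrable_prod {α p r : ℝ} (hα : -1 < α) (hp : 0 < p) (hr : 1 ≤ r) {A : ℝ≥0∞}
    (hA : A ≠ ∞) {k : Disc → Disc → ℂ} (h : AbsBounded α p r A k)
    (hk : Continuous fun x : Disc × Disc => k x.1 x.2) {f : Disc → ℂ} (hfc : Continuous f)
    (hf : MemLp f (ENNReal.ofReal p) (dA α)) :
    Integrable (fun x : Disc × Disc => f x.1 * k x.1 x.2) ((dA α).prod (dA α)) := by
  have := isProbabilityMeasure_dA hα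
  have hr0 : 0 < r := by linarith
  have hc : Continuous fun x : Disc × Disc => f x.1 * k x.1 x.2 := (hfc.comp continuous_fst).mul hk
  refine ⟨hc.aestronglyMeasurable, ?_⟩
  have hfm : Measurable fun z => ‖f z‖ₑ := hfc.enorm.measurable
  have hkm : Measurable fun x : Disc × Disc => ‖k x.1 x.2‖ₑ := hk.enorm.measurable
  have hm2 : Measurable fun x : Disc × Disc => ‖f x.1‖ₑ * ‖k x.1 x.2‖ₑ := by fun_prop
  have hm3 : Measurable fun w => ∫⁻ z, ‖f z‖ₑ * ‖k z w‖ₑ ∂(dA α) := hm2.lintegral_prod_left'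
  have h1 := h.rpow_le hp hr0 hfm
  -- Hölder's inequality against the constant `1` on a probability space passes from the `L^r` bound
  -- to an `L^1` bound.
  have h2 := ENNReal.lintegral_mul_norm_pow_le (μ := dA α)
    (f := fun w => (∫⁻ z, ‖f z‖ₑ * ‖k z w‖ₑ ∂(dA α)) ^ r) (g := fun _ => 1)
    (hm3.pow_const r).aemeasurable aemeasurable_const (p := 1 / r) (q := 1 - 1 / r) (by positivity)
    (by rw [sub_nonneg]; exact div_le_one_of_le₀ hr hr0.le) (by ring)
  simp_rw [← ENNReal.rpow_mul, mul_one_div_cancel hr0.ne', ENNReal.rpow_one, ENNReal.one_rpow,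
    mul_one, lintegral_one, measure_univ, ENNReal.one_rpow, mul_one] at h2
  rw [HasFiniteIntegral, lintegral_prod_symm' _ hc.enorm.measurable]
  simp_rw [enorm_mul]
  refine (h2.trans h1).trans_lt (ENNReal.mul_lt_top ?_ ?_)
  · exact ENNReal.rpow_lt_top_of_nonneg (by positivity) hA
  · exact ENNReal.rpow_lt_top_of_nonneg (by positivity) (lintegral_rpow_ne_top hp hf)

/-- Fubini's theorem alone gives this for almost every `w`. Analyticity of `k z` bounds `|k z w|` by
its `L^1` norm and yields every `w`. -/
lemma AbsBounded.integrable {α p r : ℝ} (hα : -1 < α) (hp : 0 < p) (hr : 1 ≤ r) {A : ℝ≥0∞}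
    (hA : A ≠ ∞) {k : Disc → Disc → ℂ} (h : AbsBounded α p r A k)
    (hk : Continuous fun x : Disc × Disc => k x.1 x.2) (hka : ∀ z, IsAnalytic (k z)) {f : Disc → ℂ}
    (hfc : Continuous f) (hf : MemLp f (ENNReal.ofReal p) (dA α)) (w : Disc) :
    Integrable (fun z => f z * k z w) (dA α) := by
  have := isProbabilityMeasure_dA hα
  have hi := h.integrable_prod hα hp hr hA hk hfc hf
  have hc : Continuous fun x : Disc × Disc => f x.1 * k x.1 x.2 := (hfc.comp continuous_fst).mul hk
  have hcw := hc.comp (Continuous.prodMk_left w)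
  refine ⟨hcw.aestronglyMeasurable, ?_⟩
  have h1 := hi.2
  rw [HasFiniteIntegral, lintegral_prod _ hc.enorm.measurable.aemeasurable] at h1
  calc ∫⁻ z, ‖f z * k z w‖ₑ ∂(dA α)
      ≤ ∫⁻ z, ENNReal.ofReal ((rho w / 2) ^ (-(2 + α))) *
        ∫⁻ u, ‖f z * k z u‖ₑ ∂(dA α) ∂(dA α) := by
        refine lintegral_mono fun z => ?_
        simp_rw [enorm_mul]
        rw [lintegral_const_mul' _ _ enorm_ne_top, mul_left_comm]
        gcongr
        exact (hka z).enorm_le hα w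
    _ < ∞ := by
        rw [lintegral_const_mul' _ _ ENNReal.ofReal_ne_top]
        exact ENNReal.mul_lt_top ENNReal.ofReal_lt_top h1

/-- Since each `k z` reproduces itself, Fubini's theorem shows that the function equals its own
Bergman projection, which is analytic. -/
lemma AbsBounded.isAnalytic {α p r : ℝ} (hα : -1 < α) (hp : 0 < p) (hr : 1 ≤ r) {A : ℝ≥0∞}
    (hA : A ≠ ∞) {k : Disc → Disc → ℂ} (h : AbsBounded α p r A k)
    (hk : Continuous fun x : Disc × Disc => k x.1 x.2) (hka : ∀ z, IsAnalytic (k z))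
    (hki : ∀ z, Integrable (k z) (dA α)) {f : Disc → ℂ}
    (hfc : Continuous f) (hf : MemLp f (ENNReal.ofReal p) (dA α)) :
    IsAnalytic fun w => ∫ z, f z * k z w ∂(dA α) := by
  have := isProbabilityMeasure_dA hα
  have hi := h.integrable_prod hα hp hr hA hk hfc hf
  have hg : Integrable (fun u => ∫ z, f z * k z u ∂(dA α)) (dA α) := hi.integral_prod_right
  have h1 : (fun w => ∫ z, f z * k z w ∂(dA α))
      = fun w => ∫ u, (∫ z, f z * k z u ∂(dA α)) * kernel α u w ∂(dA α) := by
    funext w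
    have hprod : Integrable (Function.uncurry fun z u => f z * k z u * kernel α u w)
        ((dA α).prod (dA α)) := by
      have hkc : Continuous fun x : Disc × Disc => kernel α x.2 w :=
        (continuous_kernel_left α w).comp continuous_snd
      exact hi.mul_bdd (c := (rho w / 2) ^ (-(2 + α))) hkc.aestronglyMeasurable
        (ae_of_all _ fun x => norm_kernel_le hα x.2 w)
    simp_rw [← integral_mul_const]
    rw [← integral_integral_swap hprod]
    refine integral_congr_ae (ae_of_all _ fun z => ?_)
    simp only
    simp_rw [mul_assoc]
    rw [integral_const_mul, (hka z).integral_mul_kernel hα (hki z) w]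
  rw [h1]
  exact isAnalytic_integral_mul_kernel hα hg

lemma AbsBounded.eLpNorm_le {α p r : ℝ} (hp : 0 < p) (hr : 0 < r) {A : ℝ≥0∞}
    {k : Disc → Disc → ℂ} (h : AbsBounded α p r A k) {f : Disc → ℂ} (hfc : Continuous f) :
    eLpNorm (fun w => ∫ z, f z * k z w ∂(dA α)) (ENNReal.ofReal r) (dA α)
      ≤ A ^ (1 / r) * eLpNorm f (ENNReal.ofReal p) (dA α) := by
  rw [eLpNorm_ofReal hp, eLpNorm_ofReal hr]
  refine le_trans ?_ (h.rpow_le hp hr hfc.enorm.measurable)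
  gcongr with w
  refine (enorm_integral_le_lintegral_enorm _).trans_eq ?_
  simp_rw [enorm_mul]

lemma continuous_toLp {X : Type*} [TopologicalSpace X] {α : ℝ} {P : ℝ≥0∞} [Fact (1 ≤ P)]
    {k : X → Disc → ℂ} (hk : ∀ z, MemLp (k z) P (dA α))
    (hc : ∀ z₀, Tendsto (fun z => eLpNorm (k z - k z₀) P (dA α)) (𝓝 z₀) (𝓝 0)) :
    Continuous fun z => (hk z).toLp (k z) := by
  rw [continuous_iff_continuousAt]
  intro z₀
  rw [ContinuousAt, Lp.tendsto_Lp_iff_tendsto_eLpNorm'' _ hk _ (hk z₀)]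
  exact hc z₀

/-! ### The closure of the graph and the bounded extension. -/

namespace Operator

variable {p q α : ℝ}

/-- The graph of `S` in `L^p × L^r`. -/
def graphLp (S : Operator p q α) (r : ℝ) [Fact (1 ≤ ENNReal.ofReal p)]
    [Fact (1 ≤ ENNReal.ofReal r)] :
    Submodule ℂ (Lp ℂ (ENNReal.ofReal p) (dA α) × Lp ℂ (ENNReal.ofReal r) (dA α)) where
  carrier := {x | ∃ g : S.domain, x.1 =ᵐ[dA α] (g : Disc → ℂ) ∧
    x.2 =ᵐ[dA α] (S.toFun g : Disc → ℂ)}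
  add_mem' := by
    rintro x y ⟨g, hg1, hg2⟩ ⟨g', hg1', hg2'⟩
    refine ⟨g + g', ?_, ?_⟩
    · exact (Lp.coeFn_add _ _).trans (hg1.add hg1')
    · rw [map_add]
      exact (Lp.coeFn_add _ _).trans (hg2.add hg2')
  zero_mem' := by
    refine ⟨0, Lp.coeFn_zero _ _ _, ?_⟩
    rw [map_zero]
    exact Lp.coeFn_zero _ _ _
  smul_mem' := by
    rintro c x ⟨g, hg1, hg2⟩
    refine ⟨c • g, ?_, ?_⟩
    · exact (Lp.coeFn_smul _ _).trans (hg1.const_smul c)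
    · rw [map_smul]
      exact (Lp.coeFn_smul _ _).trans (hg2.const_smul c)

/-- The pairs `f(z) (K_z, S K_z)` lie in the graph and depend continuously on `z`, so their
integrals over compact sets lie in its closure. By the absolute bounds the two components converge
to `f`, through the reproducing formula, and to `g`. -/
lemma mem_closure_graphLp (S : Operator p q α) (hα : -1 < α) (hp : 1 < p) {r : ℝ} (hr : 1 ≤ r)
    [Fact (1 ≤ ENNReal.ofReal p)] [Fact (1 ≤ ENNReal.ofReal r)]
    (hmem : ∀ z, MemLp (S.kern z) (ENNReal.ofReal r) (dA α))
    (hc : ∀ z₀, Tendsto (fun z => eLpNorm (S.kern z - S.kern z₀) (ENNReal.ofReal r) (dA α)) (𝓝 z₀)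
      (𝓝 0)) {A : ℝ≥0∞} (hA : A ≠ ∞) (h : AbsBounded α p r A S.kern) {f : Disc → ℂ}
    (hf : IsAnalytic f) (hfp : MemLp f (ENNReal.ofReal p) (dA α)) {g : Disc → ℂ}
    (hg : MemLp g (ENNReal.ofReal r) (dA α)) (hgf : ∀ w, g w = ∫ z, f z * S.kern z w ∂(dA α)) :
    (hfp.toLp f, hg.toLp g) ∈ (S.graphLp r).topologicalClosure := by
  have := isProbabilityMeasure_dA hα
  have hp0 : 0 < p := by linarith
  have hr0 : 0 < r := by linarith
  have hk := S.continuous_kern hα hr hc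
  have hKmem : ∀ z, MemLp (kernel α z) (ENNReal.ofReal p) (dA α) := fun z =>
    memLp_of_mem (S.domain_le (S.kernel_mem z))
  obtain ⟨A', hA', hKb⟩ := exists_absBounded_kernel hα hp
  set Λ : Disc → Lp ℂ (ENNReal.ofReal p) (dA α) × Lp ℂ (ENNReal.ofReal r) (dA α) := fun z =>
    f z • ((hKmem z).toLp (kernel α z), (hmem z).toLp (S.kern z)) with hΛ
  have hΛc : Continuous Λ := hf.continuous.smul
    ((continuous_toLp hKmem (tendsto_eLpNorm_kernel hα hp.le)).prodMk (continuous_toLp hmem hc))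
  have hΛi : ∀ n, IntegrableOn Λ (exhaustion n) (dA α) := fun n =>
    hΛc.continuousOn.integrableOn_compact (isCompact_exhaustion n)
  have hΛm : ∀ z, Λ z ∈ (S.graphLp r).topologicalClosure := fun z => by
    refine Submodule.smul_mem _ _ (Submodule.le_topologicalClosure _ ?_)
    exact ⟨⟨kernel α z, S.kernel_mem z⟩, (hKmem z).coeFn_toLp, (hmem z).coeFn_toLp⟩
  have hIm : ∀ n, ∫ z in exhaustion n, Λ z ∂(dA α) ∈ (S.graphLp r).topologicalClosure := fun n =>
    integral_mem_of_isClosed _ (Submodule.isClosed_topologicalClosure _) (hΛi n) hΛm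
  -- One convergence statement serves both components: `k = kernel α`, `s = p`, and `k = S.kern`, `s
  -- = r`.
  have hlim : ∀ (s : ℝ) [Fact (1 ≤ ENNReal.ofReal s)] (k : Disc → Disc → ℂ) (A : ℝ≥0∞) (g : Disc → ℂ)
      (hs : 0 < s) (_ : Continuous fun x : Disc × Disc => k x.1 x.2)
      (hkm : ∀ z, MemLp (k z) (ENNReal.ofReal s) (dA α)) (_ : A ≠ ∞) (_ : AbsBounded α p s A k)
      (_ : ∀ w, Integrable (fun z => f z * k z w) (dA α))
      (hg : MemLp g (ENNReal.ofReal s) (dA α)) (_ : ∀ w, g w = ∫ z, f z * k z w ∂(dA α))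
      (_ : ∀ n, IntegrableOn (fun z => f z • (hkm z).toLp (k z)) (exhaustion n) (dA α)),
      Tendsto (fun n => ∫ z in exhaustion n, f z • (hkm z).toLp (k z) ∂(dA α)) atTop
        (𝓝 (hg.toLp g)) := by
    intro s _ k A g hs hkc hkm hA hAb hi hg hgk hint
    rw [Lp.tendsto_Lp_iff_tendsto_eLpNorm']
    refine (hAb.tendsto hp0 hs hA hf.continuous hfp hi).congr fun n => ?_
    refine eLpNorm_congr_ae ?_
    have hco := coeFn_integral_Lp (hint n) (G := fun z w => f z * k z w)
      (((hf.continuous.comp continuous_fst).mul hkc).stronglyMeasurable) (fun z => by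
        filter_upwards [Lp.coeFn_smul (f z) ((hkm z).toLp (k z)), (hkm z).coeFn_toLp] with w h1 h2
        rw [h1, Pi.smul_apply, h2, smul_eq_mul])
    filter_upwards [hco, hg.coeFn_toLp] with w h1 h2
    rw [Pi.sub_apply, h1, h2, hgk]
  have h1 := hlim p (kernel α) A' f hp0 (continuous_kernel α) hKmem hA' hKb
    (fun w => hKb.integrable hα hp0 hp.le hA' (continuous_kernel α) (isAnalytic_kernel α)
      hf.continuous hfp w) hfp
    (fun w => (hf.integral_mul_kernel hα (hfp.integrable Fact.out) w).symm)
    (fun n => (hΛi n).fst)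
  have h2 := hlim r S.kern A g hr0 hk hmem hA h
    (fun w => h.integrable hα hp0 hr hA hk S.isAnalytic_kern hf.continuous hfp w) hg hgf
    (fun n => (hΛi n).snd)
  refine (Submodule.isClosed_topologicalClosure _).mem_of_tendsto
    ((h1.prodMk_nhds h2).congr fun n => ?_) (Eventually.of_forall hIm)
  exact (integral_pair (hΛi n).fst (hΛi n).snd).symm

/-- `T` is the integral operator with kernel `S.kern`; the norm bound is immediate, and the content
is that `T` agrees with `S` on the domain. -/
lemma exists_extension (S : Operator p q α) (hα : -1 < α) (hp : 1 < p) (hS : S.IsClosable) {r : ℝ}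
    (hr : 1 ≤ r) (hqr : q ≤ r) (hmem : ∀ z, MemLp (S.kern z) (ENNReal.ofReal r) (dA α))
    (hc : ∀ z₀, Tendsto (fun z => eLpNorm (S.kern z - S.kern z₀) (ENNReal.ofReal r) (dA α)) (𝓝 z₀)
      (𝓝 0)) {A : ℝ≥0∞} (hA : A ≠ ∞) (h : AbsBounded α p r A S.kern) :
    ∃ T : bergmanSpace p α →ₗ[ℂ] bergmanSpace q α, S.ExtendsTo T ∧
      ∀ f : bergmanSpace p α, bnorm q α (T f : Disc → ℂ)
        ≤ A ^ (1 / r) * bnorm p α (f : Disc → ℂ) := by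
  have := isProbabilityMeasure_dA hα
  have hp0 : 0 < p := by linarith
  have hr0 : 0 < r := by linarith
  have : Fact (1 ≤ ENNReal.ofReal p) := ⟨by simpa using hp.le⟩
  have : Fact (1 ≤ ENNReal.ofReal r) := ⟨by simpa using hr⟩
  have hqr' : ENNReal.ofReal q ≤ ENNReal.ofReal r := ENNReal.ofReal_le_ofReal hqr
  have hk := S.continuous_kern hα hr hc
  have hfc : ∀ f : bergmanSpace p α, Continuous (f : Disc → ℂ) := fun f =>
    (isAnalytic_of_mem f.2).continuous
  have hint : ∀ (f : bergmanSpace p α) w,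
      Integrable (fun z => (f : Disc → ℂ) z * S.kern z w) (dA α) := fun f w =>
    h.integrable hα hp0 hr hA hk S.isAnalytic_kern (hfc f) (memLp_of_mem f.2) w
  have han : ∀ f : bergmanSpace p α,
      IsAnalytic fun w => ∫ z, (f : Disc → ℂ) z * S.kern z w ∂(dA α) := fun f =>
    h.isAnalytic hα hp0 hr hA hk S.isAnalytic_kern (fun z => (hmem z).integrable Fact.out) (hfc f)
      (memLp_of_mem f.2)
  have hle : ∀ f : bergmanSpace p α,
      eLpNorm (fun w => ∫ z, (f : Disc → ℂ) z * S.kern z w ∂(dA α)) (ENNReal.ofReal r) (dA α)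
        ≤ A ^ (1 / r) * bnorm p α (f : Disc → ℂ) := fun f => h.eLpNorm_le hp0 hr0 (hfc f)
  have hLr : ∀ f : bergmanSpace p α, MemLp (fun w => ∫ z, (f : Disc → ℂ) z * S.kern z w ∂(dA α))
      (ENNReal.ofReal r) (dA α) := fun f =>
    ⟨(han f).continuous.aestronglyMeasurable, (hle f).trans_lt (ENNReal.mul_lt_top
      (ENNReal.rpow_lt_top_of_nonneg (by positivity) hA) (memLp_of_mem f.2).2)⟩
  let T : bergmanSpace p α →ₗ[ℂ] bergmanSpace q α :=
    { toFun := fun f => ⟨fun w => ∫ z, (f : Disc → ℂ) z * S.kern z w ∂(dA α), han f,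
        (hLr f).mono_exponent hqr'⟩
      map_add' := fun f g => by
        apply Subtype.ext
        funext w
        simp only [Submodule.coe_add, Pi.add_apply, add_mul]
        exact integral_add (hint f w) (hint g w)
      map_smul' := fun c f => by
        apply Subtype.ext
        funext w
        simp only [Submodule.coe_smul, Pi.smul_apply, smul_eq_mul, mul_assoc, RingHom.id_apply]
        exact integral_const_mul _ _ }
  refine ⟨T, fun f => ?_, fun f => ?_⟩
  · set f' : bergmanSpace p α := ⟨f, S.domain_le f.2⟩ with hf'
    have hmemc := S.mem_closure_graphLp hα hp hr hmem hc hA h (isAnalytic_of_mem f'.2)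
      (memLp_of_mem f'.2) (hLr f') fun _ => rfl
    rw [← SetLike.mem_coe, Submodule.topologicalClosure_coe, mem_closure_iff_seq_limit] at hmemc
    obtain ⟨x, hx, hlim⟩ := hmemc
    choose g hg1 hg2 using hx
    have hl1 := (continuous_fst.tendsto _).comp hlim
    have hl2 := (continuous_snd.tendsto _).comp hlim
    rw [Lp.tendsto_Lp_iff_tendsto_eLpNorm'] at hl1 hl2
    -- Here `g n → f` in `L^p` and `S (g n) → T f'` in `L^r`, hence in `L^q`. Thus `f - g n → 0`
    -- while `S (f - g n) → S f - T f'`, which closability forces to vanish.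
    have hz := hS (fun n => f - g n) (S.toFun f - T f') (by
        refine hl1.congr fun n => ?_
        rw [bnorm, ← eLpNorm_neg]
        refine eLpNorm_congr_ae ?_
        filter_upwards [hg1 n, (memLp_of_mem f'.2).coeFn_toLp] with w h1 h2
        simp only [Pi.neg_apply, Pi.sub_apply, Function.comp_apply, AddSubgroupClass.coe_sub,
          neg_sub]
        rw [h1, h2]) (by
        refine tendsto_of_tendsto_of_tendsto_of_le_of_le tendsto_const_nhds hl2
          (fun _ => zero_le) fun n => ?_
        have hcont : Continuous fun w => (T f' : Disc → ℂ) w - (S.toFun (g n) : Disc → ℂ) w :=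
          (isAnalytic_of_mem (T f').2).continuous.sub
            (isAnalytic_of_mem (S.toFun (g n)).2).continuous
        have he : (S.toFun (f - g n) : Disc → ℂ) - ((S.toFun f - T f' : bergmanSpace q α) :
            Disc → ℂ) = fun w => (T f' : Disc → ℂ) w - (S.toFun (g n) : Disc → ℂ) w := by
          rw [map_sub]
          funext w
          simp
        rw [bnorm, he]
        refine (eLpNorm_le_eLpNorm_of_exponent_le hqr' hcont.aestronglyMeasurable).trans_eq ?_
        rw [← eLpNorm_neg]
        refine eLpNorm_congr_ae ?_
        filter_upwards [hg2 n, (hLr f').coeFn_toLp] with w h1 h2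
        simp only [Pi.neg_apply, Pi.sub_apply, Function.comp_apply, neg_sub]
        rw [h1, h2]
        rfl)
    exact (sub_eq_zero.1 hz).symm
  · refine le_trans ?_ (hle f)
    exact eLpNorm_le_eLpNorm_of_exponent_le hqr' (han f).continuous.aestronglyMeasurable

end Operator

namespace Operator

variable {p q α : ℝ}

lemma continuous_conjOne (S : Operator p q α) (z : Disc) : Continuous (S.conjOne z) := by
  have h : S.conjOne z = fun w => S.kern z (moebius z w) *
      (((rho z ^ ((2 + α) / 2) : ℝ) : ℂ) * normKernel α z w) := funext (S.conjOne_apply z)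
  have hn : Continuous (normKernel α z) := (isAnalytic_kernel α z).continuous.const_smul _
  rw [h]
  exact ((S.isAnalytic_kern z).continuous.comp (continuous_moebius z)).mul
    (continuous_const.mul hn)

lemma exists_extension_of_kernelBound (S : Operator p q α) (hα : -1 < α) (hp : 1 < p)
    (hS : S.IsClosable) {m r : ℝ} (hr : 1 ≤ r) (hrm : r < m) (hqr : q ≤ r) {C : ℝ≥0∞} (hC : C ≠ ∞)
    (h : ∀ z, bnorm m α (S.conjOne z) ≤ C) {K : ℝ≥0∞} (hK : K ≠ ∞)
    (hA : Measurable (Function.uncurry fun z w => ‖S.kern z w‖ₑ) →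
      AbsBounded α p r (K * C ^ r) S.kern) :
    ∃ T : bergmanSpace p α →ₗ[ℂ] bergmanSpace q α, S.ExtendsTo T ∧
      ∀ f : bergmanSpace p α, bnorm q α (T f : Disc → ℂ)
        ≤ K ^ (1 / r) * C * bnorm p α (f : Disc → ℂ) := by
  have := isProbabilityMeasure_dA hα
  have hm0 : 0 < m := by linarith
  have hr0 : 0 < r := by linarith
  have hkb := S.kernelBound hm0 h
  have hc := S.tendsto_eLpNorm_kern hα hp.le hS hC hkb hr hrm hqr
  have hmem : ∀ z, MemLp (S.kern z) (ENNReal.ofReal r) (dA α) := fun z => by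
    obtain ⟨M, hM, hle⟩ := hkb.exists_lintegral_le hα hC hm0 (rho_pos z)
    have h1 : MemLp (S.kern z) (ENNReal.ofReal m) (dA α) := by
      refine ⟨(S.isAnalytic_kern z).continuous.aestronglyMeasurable, ?_⟩
      rw [eLpNorm_ofReal hm0]
      exact ENNReal.rpow_lt_top_of_nonneg (by positivity) ((hle z le_rfl).trans_lt hM.lt_top).ne
    exact h1.mono_exponent (ENNReal.ofReal_le_ofReal hrm.le)
  have hk := S.continuous_kern hα hr hc
  obtain ⟨T, hT, hle⟩ := S.exists_extension hα hp hS hr hqr hmem hc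
    (ENNReal.mul_ne_top hK (ENNReal.rpow_ne_top_of_nonneg hr0.le hC)) (hA hk.enorm.measurable)
  refine ⟨T, hT, fun f => (hle f).trans_eq ?_⟩
  rw [ENNReal.mul_rpow_of_nonneg _ _ (by positivity), ← ENNReal.rpow_mul,
    mul_one_div_cancel hr0.ne', ENNReal.rpow_one]

/-- A bound with an extended nonnegative constant gives one with a positive real constant. -/
lemma exists_pos_extension {m r : ℝ} (hr : 0 < r) {K : ℝ≥0∞} (hK : K ≠ ∞)
    (h : ∀ S : Operator p q α, S.IsClosable → ∀ C : ℝ≥0∞, C ≠ ∞ →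
      (∀ z, bnorm m α (S.conjOne z) ≤ C) →
      ∃ T : bergmanSpace p α →ₗ[ℂ] bergmanSpace q α, S.ExtendsTo T ∧
        ∀ f : bergmanSpace p α, bnorm q α (T f : Disc → ℂ)
          ≤ K ^ (1 / r) * C * bnorm p α (f : Disc → ℂ)) :
    ∃ K : ℝ, 0 < K ∧ ∀ S : Operator p q α, S.IsClosable → ∀ C : ℝ, 0 < C →
      (∀ z, bnorm m α (S.conjOne z) ≤ ENNReal.ofReal C) →
      ∃ T : bergmanSpace p α →ₗ[ℂ] bergmanSpace q α, S.ExtendsTo T ∧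
        ∀ f : bergmanSpace p α, bnorm q α (T f : Disc → ℂ)
          ≤ ENNReal.ofReal (K * C) * bnorm p α (f : Disc → ℂ) := by
  have hK' : K ^ (1 / r) ≠ ∞ := ENNReal.rpow_ne_top_of_nonneg (by positivity) hK
  refine ⟨(K ^ (1 / r)).toReal + 1, by positivity, fun S hS C _ hSC => ?_⟩
  obtain ⟨T, hT, hle⟩ := h S hS (ENNReal.ofReal C) ENNReal.ofReal_ne_top hSC
  refine ⟨T, hT, fun f => (hle f).trans ?_⟩
  rw [ENNReal.ofReal_mul (by positivity)]
  gcongr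
  exact ENNReal.le_ofReal_iff_toReal_le hK' (by positivity) |>.2 (by linarith)

end Operator

end WeightedBergman

end

/-! ### The theorem: choice of the target exponent `r` in the two cases. -/

theorem theorem2p10 (p q m α : ℝ) (hp : 2 < p) (hα : -1 < α)
    (hm₁ : p * (2 + α) / ((p - 1) * (1 + α)) < m) (hm₂ : m ≤ p * (2 + α) / (1 + α))
    (hq : 0 < q)
    (hcase : (m ≤ p ∧ q < m * ((1 + α) / (2 + α))) ∨ (p < m ∧ q < p / (2 + α))) :
    ∃ K : ℝ, 0 < K ∧
      ∀ (S : WeightedBergman.Operator p q α), S.IsClosable →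
      ∀ C : ℝ, 0 < C →
        (∀ z : WeightedBergman.Disc,
          WeightedBergman.bnorm m α (S.conjOne z) ≤ ENNReal.ofReal C) →
        ∃ T : WeightedBergman.bergmanSpace p α →ₗ[ℂ] WeightedBergman.bergmanSpace q α,
          S.ExtendsTo T ∧
          ∀ f : WeightedBergman.bergmanSpace p α,
            WeightedBergman.bnorm q α (T f : WeightedBergman.Disc → ℂ)
              ≤ ENNReal.ofReal (K * C) *
                WeightedBergman.bnorm p α (f : WeightedBergman.Disc → ℂ) := by
  have := WeightedBergman.isProbabilityMeasure_dA hα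
  have hb : 0 < 1 + α := by linarith
  have ha : 0 < 2 + α := by linarith
  have hp1 : 1 < p := by linarith
  have hL : 1 < p * (2 + α) / ((p - 1) * (1 + α)) := by
    rw [lt_div_iff₀ (mul_pos (by linarith) hb)]
    nlinarith
  rcases hcase with ⟨hmp, hqm⟩ | ⟨hpm, hqp⟩
  · have hq' : q < m := hqm.trans_le (mul_le_of_le_one_right (by linarith)
      ((div_le_one ha).2 (by linarith)))
    -- The inequality `r < m` is strict for the compactness argument and for `r < p`, while `r`
    -- still exceeds `q` and the threshold of the Schur estimate, which is applied with `r` in place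
    -- of `m`.
    obtain ⟨r, hr1, hrm⟩ := exists_between (max_lt hm₁ hq')
    obtain ⟨hLr, hqr⟩ := max_lt_iff.1 hr1
    have hr : 1 < r := hL.trans hLr
    obtain ⟨K, hK, hle⟩ := WeightedBergman.exists_lintegral_kernel_le_of_lt hp1 hα hLr
      (hrm.trans_le hmp)
    refine WeightedBergman.Operator.exists_pos_extension (r := r) (by linarith) hK
      fun S hS C hC h => ?_
    refine S.exists_extension_of_kernelBound hα hp1 hS hr.le hrm hqr.le hC h hK fun hmeas =>
      hle _ hmeas C (S.kernelBound (by linarith) fun z => le_trans ?_ (h z))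
    -- On a probability space the bound on `S_z 1` passes from exponent `m` to `r` with the same
    -- constant.
    exact eLpNorm_le_eLpNorm_of_exponent_le (ENNReal.ofReal_le_ofReal hrm.le)
      (S.continuous_conjOne z).aestronglyMeasurable
  · have hqp' : q < p := hqp.trans_le (div_le_self (by linarith) (by linarith))
    -- Now `p < m` is strict already, so `r = p` is admissible and `m` need not be lowered.
    obtain ⟨K, hK, hle⟩ := WeightedBergman.exists_lintegral_kernel_le_of_gt hp1 hα hm₁ hpm
    refine WeightedBergman.Operator.exists_pos_extension (r := p) (by linarith) hK
      fun S hS C hC h => ?_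
    refine S.exists_extension_of_kernelBound hα hp1 hS hp1.le hpm hqp'.le hC h hK fun hmeas f hf =>
      ?_
    rw [div_self (by linarith), ENNReal.rpow_one]
    exact hle _ hmeas C (S.kernelBound (by linarith) h) f hf
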